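/- Let $Q(D,n)$ be the directed graph with vertex set $\{0,1,\dots,D\}^n$ whose edges are the pairs $(u,v)$ such that $v$ arises from $u$ by raising exactly one coordinate by $1$. Write $|x|=\sum_i x_i$, and let $\le$ be the coordinatewise order. The input is a subgraph $G$ of $Q(D,n)$, given by edge queries; the task is to decide whether $G$ contains a path from $0^n$ to $D^n$. Fix integers $D,K\ge 1$ and constants $\alpha_{k,d}\in(0,\tfrac12)$ ($1\le k\le K$, $1\le d\le D$) with $\alpha_{k,d}<\alpha_{k+1,d}$ for $1\le k<K$. Consider the following recursive procedure $\textsc{Path}(s,t)$ for vertices $s\le t$, which works in the sublattice $[s,t]$. Let $n_d$ be the number of $i$ with $t_i-s_i=d$, let $W_k=\lfloor\sum_{d=1}^D\alpha_{k,d}\,d\,n_d\rfloor$ for $1\le k\le K$, and $W_{K+1}=\lfloor(|t|-|s|)/2\rfloor$. 1. If $W_k=W_{k+1}$ for some $1\le k\le K$, query all edges of $[s,t]$, decide whether $t$ is reachable from $s$, and return. 2. Otherwise query all edges of $[s,t]$ that end in a vertex of weight at most $|s|+W_1$ and store, for every vertex $v$ of weight $|s|+W_1$, whether $v$ is reachable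 from $s$; likewise query all edges of $[s,t]$ that start in a vertex of weight at least $|t|-W_1$ and store, for every $v$ of weight $|t|-W_1$, whether $t$ is reachable from $v$. 3. Let $\textsc{LayerPath}(1,v)$ and $\textsc{LayerPath}'(1,v)$ be read from the stored values. For $2\le k\le K+1$ compute $\textsc{LayerPath}(k,v)=\bigvee_u(\textsc{LayerPath}(k-1,u)\wedge\textsc{Path}(u,v))$ by variable time quantum search (VTS) over the $u$ with $s\le u<v$ and $|u|=|s|+W_{k-1}$, and $\textsc{LayerPath}'(k,v)=\bigvee_u(\textsc{LayerPath}'(k-1,u)\wedge\textsc{Path}(v,u))$ by VTS over the $u$ with $v<u\le t$ and $|u|=|t|-W_{k-1}$. 4. Return $\bigvee_v(\textsc{LayerPath}(K+1,v)\wedge\textsc{LayerPath}'(K+1,v))$, computed by VTS over the $v\in[s,t]$ with $|v|=|s|+W_{K+1}$. Here a VTS over subroutines that make $t_1,\dots,t_N$ queries makes $\kappa\sqrt{t_1^2+\dots+t_N^2}$ queries, for some constant $\kappa>0$. For nonnegative functions of $n$, $f=\widetilde O(g)$ means $f=O(g\,|\log g|^{m})$ for some constant $m$, and $f=\widetilde\Omega(g)$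 means $f=\Omega(g/|\log g|^{m})$ for some constant $m$. **Theorem.** For all fixed integers $D\ge1$ and $K\ge1$, all constants $\alpha_{k,d}$ as above and all $\kappa>0$, on arbitrary inputs $G_n\subseteq Q(D,n)$, the algorithm $\textsc{Path}(0^n,D^n)$ makes $$\widetilde\Omega\left(\left(\frac{D+1}{e}\right)^n\right)$$ queries as $n\to\infty$. Consequently the speedup over the classical complexity $\widetilde\Theta((D+1)^n)$ is not polynomial in the size of the lattice: for every real $c<1$ there is $D_0$ such that for all $D\ge D_0$, all $K\ge1$, all constants $\alpha_{k,d}$ as above, all $\kappa>0$ and all inputs $G_n$, the number of queries is not $\widetilde O((D+1)^{cn})$. -/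

import Mathlib

namespace Hyperlattice

/-! ### The lattice graph -/

/-- Vertices of `Q(D,n)`: points of `{0,…,D}^n`, with the coordinatewise order. -/
abbrev Vertex (D n : ℕ) : Type := Fin n → Fin (D + 1)

/-- The weight `|x|`: the sum of the coordinates. -/
def weight {D n : ℕ} (x : Vertex D n) : ℕ := ∑ i, (x i : ℕ)

/-- `(u, v)` is a directed edge of `Q(D,n)`: `v` is `u` with exactly one coordinate raised by 1. -/
def IsEdge {D n : ℕ} (u v : Vertex D n) : Prop :=
  ∃ i, (v i : ℕ) = (u i : ℕ) + 1 ∧ ∀ j, j ≠ i → u j = v j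

/-- The edges of `Q(D,n)`. -/
abbrev Edge (D n : ℕ) : Type := {e : Vertex D n × Vertex D n // IsEdge e.1 e.2}

/-- A subgraph of `Q(D,n)`, given by the set of its edges: the input of the problem. -/
abbrev Subgraph (D n : ℕ) : Type := Edge D n → Bool

/-- There is a directed path from `u` to `v` in the subgraph `G`. -/
def Reachable {D n : ℕ} (G : Subgraph D n) (u v : Vertex D n) : Prop :=
  Relation.ReflTransGen (fun a b => ∃ h : IsEdge a b, G ⟨(a, b), h⟩ = true) u v

/-! ### Query algorithms with variable time quantum search -/

/-- Query algorithms with a Boolean output. `E` is the set of possible queries, `ι` the type of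
objects that are searched over. An algorithm stops with an answer, or queries some `e : E` and
continues according to the answer, or runs a variable time quantum search (VTS) over a family of
algorithms indexed by a finite set and continues according to its outcome. -/
inductive QAlg (E ι : Type) : Type
  | ret (b : Bool) : QAlg E ι
  | query (e : E) (k : Bool → QAlg E ι) : QAlg E ι
  | vts (S : Finset ι) (A : {x // x ∈ S} → QAlg E ι) (k : Bool → QAlg E ι) : QAlg E ι

namespace QAlg

variable {E ι : Type}

open scoped Classical in
/-- The output on input `G`; VTS computes the disjunction of the outputs of its subroutines. -/
noncomputable def eval (G : E → Bool) : QAlg E ι → Bool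
  | ret b => b
  | query e k => eval G (k (G e))
  | vts _ A k => eval G (k (decide (∃ i, eval G (A i) = true)))

open scoped Classical in
/-- The number of queries made on input `G`. A VTS over subroutines that make `t₁, …, t_N` queries
makes `κ * √(t₁² + ⋯ + t_N²)` queries. (In the algorithm below the numbers `t_i` do not depend on
the input `G`, as all branches of its subroutines make the same number of queries.) -/
noncomputable def queries (κ : ℝ) (G : E → Bool) : QAlg E ι → ℝ
  | ret _ => 0
  | query e k => 1 + queries κ G (k (G e))
  | vts _ A k => κ * Real.sqrt (∑ i, queries κ G (A i) ^ 2) +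
      queries κ G (k (decide (∃ i, eval G (A i) = true)))

/-- Run an algorithm and continue with its output. -/
def bind : QAlg E ι → (Bool → QAlg E ι) → QAlg E ι
  | ret b, f => f b
  | query e k, f => query e fun b => bind (k b) f
  | vts S A k, f => vts S A fun b => bind (k b) f

/-- Run both algorithms and return the conjunction of their outputs. -/
def both (A B : QAlg E ι) : QAlg E ι := A.bind fun a => B.bind fun b => ret (a && b)

/-- Query the listed items one after the other and continue with the table of the answers
(`false` at the items that are not listed). -/
def queryList [DecidableEq E] : List E → ((E → Bool) → QAlg E ι) → QAlg E ι
  | [], k => k fun _ => false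
  | e :: l, k => query e fun b => queryList l fun f => k (Function.update f e b)

/-- Query every element of a finite set once and continue with the table of the answers. -/
noncomputable def queryAll [DecidableEq E] (S : Finset E) (k : (E → Bool) → QAlg E ι) :
    QAlg E ι :=
  queryList S.toList k

end QAlg

/-! ### The algorithm -/

section Algorithm

variable {D n : ℕ}

/-- Query algorithms for subgraphs of `Q(D,n)` that search over vertices. -/
abbrev LatticeAlg (D n : ℕ) : Type := QAlg (Edge D n) (Vertex D n)

open scoped Classical in
/-- The edges of the sublattice `[s, t]` whose endpoint has weight at most `w`. -/
noncomputable def edgesBelow (s t : Vertex D n) (w : ℕ) : Finset (Edge D n) :=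
  {e | s ≤ e.1.1 ∧ e.1.2 ≤ t ∧ weight e.1.2 ≤ w}

open scoped Classical in
/-- The edges of the sublattice `[s, t]` whose starting point has weight at least `w`. -/
noncomputable def edgesAbove (s t : Vertex D n) (w : ℕ) : Finset (Edge D n) :=
  {e | s ≤ e.1.1 ∧ e.1.2 ≤ t ∧ w ≤ weight e.1.1}

/-- `n_d`: the number of coordinates `i` with `t_i - s_i = d`. -/
def coordCount (s t : Vertex D n) (d : ℕ) : ℕ :=
  (Finset.univ.filter fun i => (t i : ℕ) - (s i : ℕ) = d).card

/-- The relative layer weights: `W_k = ⌊∑_{d=1}^D α_{k,d} d n_d⌋` for `k ≤ K` and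
`W_{K+1} = ⌊(|t| - |s|) / 2⌋`. -/
noncomputable def layerWeight (K : ℕ) (α : ℕ → ℕ → ℝ) (s t : Vertex D n) (k : ℕ) : ℕ :=
  if k ≤ K then ⌊∑ d ∈ Finset.Icc 1 D, α k d * d * coordCount s t d⌋₊
  else (weight t - weight s) / 2

open scoped Classical in
/-- The vertices `u` with `s ≤ u < v` and weight `|s| + w`. -/
noncomputable def layerBelow (s v : Vertex D n) (w : ℕ) : Finset (Vertex D n) :=
  {u | s ≤ u ∧ u < v ∧ weight u = weight s + w}

open scoped Classical in
/-- The vertices `u` with `v < u ≤ t` and weight `|t| - w`. -/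
noncomputable def layerAbove (v t : Vertex D n) (w : ℕ) : Finset (Vertex D n) :=
  {u | v < u ∧ u ≤ t ∧ weight u + w = weight t}

open scoped Classical in
/-- The vertices of the sublattice `[s, t]` of weight `|s| + w`. -/
noncomputable def layer (s t : Vertex D n) (w : ℕ) : Finset (Vertex D n) :=
  {v | s ≤ v ∧ v ≤ t ∧ weight v = weight s + w}

/-- `LayerPath(k, v)` for the layers `k = 1, 2, …`. `P` is the procedure `Path`, `W` the layer
weights and `dp` the table stored in the precalculation. (The index `0` is not used.) -/
noncomputable def layerPath (P : Vertex D n → Vertex D n → LatticeAlg D n) (W : ℕ → ℕ)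
    (s : Vertex D n) (dp : Vertex D n → Bool) : ℕ → Vertex D n → LatticeAlg D n
  | 0, _ => .ret false
  | 1, v => .ret (dp v)
  | k + 2, v => .vts (layerBelow s v (W (k + 1)))
      (fun u => (layerPath P W s dp (k + 1) u.1).both (P u.1 v)) .ret

/-- `LayerPath'(k, v)`, the mirror image of `LayerPath(k, v)`. -/
noncomputable def layerPath' (P : Vertex D n → Vertex D n → LatticeAlg D n) (W : ℕ → ℕ)
    (t : Vertex D n) (dp' : Vertex D n → Bool) : ℕ → Vertex D n → LatticeAlg D n
  | 0, _ => .ret false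
  | 1, v => .ret (dp' v)
  | k + 2, v => .vts (layerAbove v t (W (k + 1)))
      (fun u => (layerPath' P W t dp' (k + 1) u.1).both (P v u.1)) .ret

open scoped Classical in
/-- The body of the procedure `Path(s, t)`, where `P` is called for the recursive calls. If two
consecutive layer weights agree, all edges of the sublattice are queried (classical dynamic
programming). Otherwise the edges needed for the values `dp` up to weight `|s| + W_1` and for the
values `dp'` from weight `|t| - W_1` on are queried, and then VTS is run over the middle layer. -/
noncomputable def pathBody (K : ℕ) (α : ℕ → ℕ → ℝ)
    (P : Vertex D n → Vertex D n → LatticeAlg D n) (s t : Vertex D n) : LatticeAlg D n :=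
  let W := layerWeight K α s t
  if ∃ k ∈ Finset.Icc 1 K, W k = W (k + 1) then
    .queryAll (edgesBelow s t (weight t)) fun T => .ret (decide (Reachable T s t))
  else
    .queryAll (edgesBelow s t (weight s + W 1)) fun T =>
    .queryAll (edgesAbove s t (weight t - W 1)) fun T' =>
    .vts (layer s t (W (K + 1)))
      (fun v =>
        (layerPath P W s (fun u => decide (Reachable T s u)) (K + 1) v.1).both
          (layerPath' P W t (fun u => decide (Reachable T' u t)) (K + 1) v.1))
      .ret

/-- The procedure `Path(s, t)`. The `if` only makes the recursion visibly well-founded: for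
admissible parameters it always takes its first branch, see `path_eq`. -/
noncomputable def path (K : ℕ) (α : ℕ → ℕ → ℝ) (s t : Vertex D n) : LatticeAlg D n :=
  pathBody K α
    (fun u v => if _h : weight v - weight u < weight t - weight s then path K α u v
      else .ret false) s t
termination_by weight t - weight s

/-- Admissible layer parameters: `α_{k,d} ∈ (0, 1/2)` for `k ∈ [K]`, `d ∈ [D]`, strictly increasing
in `k`. (Values at other indices are never used.) -/
structure Admissible (D K : ℕ) (α : ℕ → ℕ → ℝ) : Prop where
  pos : ∀ k ∈ Finset.Icc 1 K, ∀ d ∈ Finset.Icc 1 D, 0 < α k d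
  lt_half : ∀ k ∈ Finset.Icc 1 K, ∀ d ∈ Finset.Icc 1 D, α k d < 1 / 2
  lt_succ : ∀ k, 1 ≤ k → k < K → ∀ d ∈ Finset.Icc 1 D, α k d < α (k + 1) d

theorem weight_mono {u v : Vertex D n} (h : u ≤ v) : weight u ≤ weight v :=
  Finset.sum_le_sum fun i _ => h i

theorem sum_mul_coordCount {s t : Vertex D n} (h : s ≤ t) :
    ∑ d ∈ Finset.Icc 1 D, d * coordCount s t d = weight t - weight s := by
  have h1 : weight t - weight s = ∑ i, ((t i : ℕ) - (s i : ℕ)) :=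
    (Finset.sum_tsub_distrib _ fun i _ => Fin.le_def.1 (h i)).symm
  have h2 : ∀ d, d * coordCount s t d =
      ∑ i, if (t i : ℕ) - (s i : ℕ) = d then d else 0 := by
    intro d
    rw [← Finset.sum_filter, Finset.sum_const, smul_eq_mul, mul_comm, coordCount]
  rw [h1, Finset.sum_congr rfl fun d _ => h2 d, Finset.sum_comm]
  refine Finset.sum_congr rfl fun i _ => ?_
  rw [Finset.sum_ite_eq]
  simp only [Finset.mem_Icc]
  have := (t i).isLt
  split_ifs <;> omega

theorem layerWeight_le_half {K : ℕ} {α : ℕ → ℕ → ℝ} (hα : Admissible D K α)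
    {s t : Vertex D n} (h : s ≤ t) {k : ℕ} (hk : 1 ≤ k) :
    layerWeight K α s t k ≤ (weight t - weight s) / 2 := by
  unfold layerWeight
  split_ifs with hkK
  · rw [Nat.le_div_iff_mul_le (by norm_num)]
    have h1 : (⌊∑ d ∈ Finset.Icc 1 D, α k d * d * coordCount s t d⌋₊ : ℝ) ≤
        ∑ d ∈ Finset.Icc 1 D, α k d * d * coordCount s t d :=
      Nat.floor_le <| Finset.sum_nonneg fun d hd =>
        mul_nonneg (mul_nonneg (hα.pos k (Finset.mem_Icc.2 ⟨hk, hkK⟩) d hd).le d.cast_nonneg)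
          (Nat.cast_nonneg _)
    have h2 : ∑ d ∈ Finset.Icc 1 D, α k d * d * coordCount s t d ≤
        ∑ d ∈ Finset.Icc 1 D, 1 / 2 * ((d * coordCount s t d : ℕ) : ℝ) := by
      refine Finset.sum_le_sum fun d hd => ?_
      rw [Nat.cast_mul, mul_assoc]
      exact mul_le_mul_of_nonneg_right (hα.lt_half k (Finset.mem_Icc.2 ⟨hk, hkK⟩) d hd).le
        (by positivity)
    rw [← Finset.mul_sum, ← Nat.cast_sum, sum_mul_coordCount h] at h2
    have h3 := h1.trans h2
    have : ((⌊∑ d ∈ Finset.Icc 1 D, α k d * d * coordCount s t d⌋₊ * 2 : ℕ) : ℝ) ≤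
        ((weight t - weight s : ℕ) : ℝ) := by
      push_cast [-Nat.cast_sub] at h3 ⊢
      linarith
    exact_mod_cast this
  · exact le_rfl

theorem layerPath_congr {P P' : Vertex D n → Vertex D n → LatticeAlg D n} (W : ℕ → ℕ)
    (s m : Vertex D n) (dp : Vertex D n → Bool)
    (hP : ∀ u v, s ≤ u → u < v → v ≤ m → P u v = P' u v) :
    ∀ k v, v ≤ m → layerPath P W s dp k v = layerPath P' W s dp k v
  | 0, _, _ => rfl
  | 1, _, _ => rfl
  | k + 2, v, hv => by
    unfold layerPath
    congr 1
    funext u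
    obtain ⟨u, hu⟩ := u
    simp only [layerBelow, Finset.mem_filter, Finset.mem_univ, true_and] at hu
    dsimp only
    rw [layerPath_congr W s m dp hP (k + 1) u (hu.2.1.le.trans hv), hP u v hu.1 hu.2.1 hv]

theorem layerPath'_congr {P P' : Vertex D n → Vertex D n → LatticeAlg D n} (W : ℕ → ℕ)
    (t m : Vertex D n) (dp : Vertex D n → Bool)
    (hP : ∀ u v, m ≤ u → u < v → v ≤ t → P u v = P' u v) :
    ∀ k v, m ≤ v → layerPath' P W t dp k v = layerPath' P' W t dp k v
  | 0, _, _ => rfl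
  | 1, _, _ => rfl
  | k + 2, v, hv => by
    unfold layerPath'
    congr 1
    funext u
    obtain ⟨u, hu⟩ := u
    simp only [layerAbove, Finset.mem_filter, Finset.mem_univ, true_and] at hu
    dsimp only
    rw [layerPath'_congr W t m dp hP (k + 1) u (hv.trans hu.1.le), hP v u hv hu.1 hu.2.1]

/-- `Path` is its body with `Path` itself for the recursive calls. -/
theorem path_eq {K : ℕ} (hK : 1 ≤ K) {α : ℕ → ℕ → ℝ} (hα : Admissible D K α)
    {s t : Vertex D n} (h : s ≤ t) : path K α s t = pathBody K α (path K α) s t := by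
  rw [path]
  unfold pathBody
  dsimp only
  split_ifs with hW
  · rfl
  have hWK : layerWeight K α s t K ≠ layerWeight K α s t (K + 1) :=
    fun hc => hW ⟨K, Finset.mem_Icc.2 ⟨hK, le_rfl⟩, hc⟩
  have h1 := layerWeight_le_half hα h hK
  have h2 : layerWeight K α s t (K + 1) = (weight t - weight s) / 2 := by
    simp [layerWeight]
  congr 1
  funext T
  congr 1
  funext T'
  congr 1
  funext v
  obtain ⟨v, hv⟩ := v
  simp only [layer, Finset.mem_filter, Finset.mem_univ, true_and] at hv
  obtain ⟨hsv, hvt, hvw⟩ := hv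
  dsimp only
  rw [layerPath_congr (P' := path K α) _ s v _ ?_ _ _ le_rfl,
    layerPath'_congr (P' := path K α) _ t v _ ?_ _ _ le_rfl]
  · intro a b ha hab hb
    have := weight_mono ha
    have := weight_mono hb
    exact dif_pos (by omega)
  · intro a b ha hab hb
    have := weight_mono ha
    have := weight_mono hb
    exact dif_pos (by omega)

/-- The algorithm for the path problem on `Q(D,n)`: `Path(0^n, D^n)`. -/
noncomputable def latticePath (D n K : ℕ) (α : ℕ → ℕ → ℝ) : LatticeAlg D n :=
  path K α (fun _ => 0) (fun _ => Fin.last D)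

end Algorithm

/-! ### Bounds up to logarithmic factors -/

/-- `f = Õ(g)`: `f = O(g log^m g)` for some constant `m`. -/
def IsOTilde (f g : ℕ → ℝ) : Prop :=
  ∃ m : ℕ, f =O[Filter.atTop] fun n => g n * |Real.log (g n)| ^ m

/-- `f = Ω̃(g)`: `f = Ω(g / log^m g)` for some constant `m`. -/
def IsOmegaTilde (f g : ℕ → ℝ) : Prop :=
  ∃ m : ℕ, (fun n => g n / |Real.log (g n)| ^ m) =O[Filter.atTop] f

end Hyperlattice

/-! Squared costs add up under VTS: the square of the cost is `κ ^ 2` times the sum of the squared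
costs of the subroutines. Following one recursive branch through the nested searches therefore turns
the squared cost of `Path(0^n, D^n)` into a count of lattice points. A nontrivial call costs at
least a constant (`exists_pos_le_queries_path`), so the squared cost of `Path(u, v)` dominates the
size of the middle layer of `[u, v]` (`exists_mul_card_mid_layer_le`). Summing over chains of layers
(`mul_card_layer_le_sq_queries_layerPath`), the squared total dominates, for each `k`, the number of
pairs `w ≤ v` with `|v| = ⌊nD/2⌋` and `|w| = M`, where `M` lies half-way between `W_k` and
`W_{k+1}`.

If `W_1` is at least about `nD/4`, the precalculation alone is expensive enough. Otherwise some `k`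
has `W_k` below and `W_{k+1}` above that threshold, and `M` stays at distance about `nD/8` from both
`0` and `nD/2`. To count the pairs, take below `v` the box `[0, b]` with `b_i = ⌊v_i (D - v_i) /
D⌋`. Its weight is at most `nD/4`, so half of its points have weight at most `nD/8`, and by
unimodality no layer of `[0, v]` that low exceeds layer `M`. Summing `∏ (b_i + 1)` over the middle
layer gives, again by unimodality, the `n`-th power of `∑_j (⌊j (D - j) / D⌋ + 1)` up to a factor
`nD + 1`. That sum is at least `((D + 1) / e) ^ 2`, as its leading coefficient is `1/6 > 1/e^2`; a
square root finishes the bound.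

For the second claim, `(D + 1) / e` exceeds `(D + 1) ^ c` for large `D`, and the exponential gap
beats all logarithmic factors. -/

namespace Hyperlattice

/-! ### Query counts of composed algorithms -/

namespace QAlg

variable {E ι : Type}

theorem queries_nonneg {κ : ℝ} (hκ : 0 ≤ κ) (G : E → Bool) (A : QAlg E ι) :
    0 ≤ A.queries κ G := by
  induction A with
  | ret b => simp [queries]
  | query e k ih => rw [queries]; linarith [ih (G e)]
  | vts S A k _ ih => rw [queries]; exact add_nonneg (by positivity) (ih _)

theorem queries_bind (κ : ℝ) (G : E → Bool) (A : QAlg E ι) (f : Bool → QAlg E ι) :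
    (A.bind f).queries κ G = A.queries κ G + (f (A.eval G)).queries κ G := by
  induction A with
  | ret b => simp [queries, bind, eval]
  | query e k ih => simp only [queries, bind, eval, ih, add_assoc]
  | vts S A k _ ih => simp only [queries, bind, eval, ih, add_assoc]

theorem queries_both (κ : ℝ) (G : E → Bool) (A B : QAlg E ι) :
    (A.both B).queries κ G = A.queries κ G + B.queries κ G := by
  simp [both, queries_bind, queries]

/-- The table `T` holds the answers, but its content is irrelevant for lower bounds that hold for
every continuation. -/
theorem exists_queries_queryList [DecidableEq E] (κ : ℝ) (G : E → Bool) (l : List E)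
    (k : (E → Bool) → QAlg E ι) :
    ∃ T, (queryList l k).queries κ G = l.length + (k T).queries κ G := by
  induction l generalizing k with
  | nil => exact ⟨fun _ => false, by simp [queryList]⟩
  | cons e l ih =>
    obtain ⟨T, hT⟩ := ih fun f => k (Function.update f e (G e))
    refine ⟨Function.update T e (G e), ?_⟩
    rw [queryList, queries, hT]
    push_cast [List.length_cons]
    ring

theorem exists_queries_queryAll [DecidableEq E] (κ : ℝ) (G : E → Bool) (S : Finset E)
    (k : (E → Bool) → QAlg E ι) :
    ∃ T, (queryAll S k).queries κ G = S.card + (k T).queries κ G := by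
  simpa [queryAll] using exists_queries_queryList κ G S.toList k

theorem sq_queries_vts_ret {κ : ℝ} (G : E → Bool) (S : Finset ι)
    (A : {x // x ∈ S} → QAlg E ι) :
    ((vts S A .ret).queries κ G) ^ 2 = κ ^ 2 * ∑ i, (A i).queries κ G ^ 2 := by
  rw [queries, queries, add_zero, mul_pow, Real.sq_sqrt]
  positivity

theorem mul_sum_le_sq_queries_vts {κ : ℝ} (G : E → Bool) (S : Finset ι)
    (A : {x // x ∈ S} → QAlg E ι) (g : ι → ℝ)
    (hg : ∀ i, g i.1 ≤ (A i).queries κ G ^ 2) :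
    κ ^ 2 * ∑ x ∈ S, g x ≤ ((vts S A .ret).queries κ G) ^ 2 := by
  rw [sq_queries_vts_ret, ← Finset.sum_coe_sort]
  exact mul_le_mul_of_nonneg_left (Finset.sum_le_sum fun i _ => hg i) (sq_nonneg _)

end QAlg

/-! ### Edges and layers of sublattices -/

section Geometry

variable {D n : ℕ}

theorem weight_update_add_one (u : Vertex D n) (i : Fin n) (a : Fin (D + 1))
    (ha : (a : ℕ) = (u i : ℕ) + 1) : weight (Function.update u i a) = weight u + 1 := by
  unfold weight
  rw [← Finset.add_sum_erase _ _ (Finset.mem_univ i),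
    ← Finset.add_sum_erase _ (fun j => (u j : ℕ)) (Finset.mem_univ i),
    Finset.sum_congr rfl (g := fun j => (u j : ℕ))]
  · simp [ha]; ring
  · intro j hj
    rw [Function.update_of_ne (Finset.ne_of_mem_erase hj)]

theorem weight_strictMono {u v : Vertex D n} (h : u < v) : weight u < weight v := by
  obtain ⟨hle, i, hi⟩ := Pi.lt_def.1 h
  exact Finset.sum_lt_sum (fun j _ => hle j) ⟨i, Finset.mem_univ i, hi⟩

theorem eq_of_le_of_weight_le {u v : Vertex D n} (h : u ≤ v) (hw : weight v ≤ weight u) :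
    u = v := by
  by_contra hne
  exact absurd (weight_strictMono (lt_of_le_of_ne h hne)) (not_lt.2 hw)

/-- A vertex below `v` is the start of an edge that stays below `v`. -/
theorem exists_edge_of_lt {u v : Vertex D n} (h : u < v) :
    ∃ w, IsEdge u w ∧ u ≤ w ∧ w ≤ v ∧ weight w = weight u + 1 := by
  obtain ⟨hle, i, hi⟩ := Pi.lt_def.1 h
  have hi' : (u i : ℕ) < v i := hi
  have hv := (v i).isLt
  refine ⟨Function.update u i ⟨(u i : ℕ) + 1, by omega⟩, ⟨i, by simp, fun j hj => ?_⟩, ?_, ?_,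
    weight_update_add_one _ _ _ rfl⟩
  · rw [Function.update_of_ne hj]
  · rw [le_update_iff]
    exact ⟨Fin.le_def.2 (by simp), fun _ _ => le_rfl⟩
  · rw [update_le_iff]
    exact ⟨Fin.le_def.2 hi', fun j _ => hle j⟩

theorem exists_weight_eq {u v : Vertex D n} (h : u ≤ v) {m : ℕ} (hu : weight u ≤ m)
    (hv : m ≤ weight v) : ∃ w, u ≤ w ∧ w ≤ v ∧ weight w = m := by
  induction m, hu using Nat.le_induction with
  | base => exact ⟨u, le_rfl, h, rfl⟩
  | succ m hm ih =>
    obtain ⟨w, huw, hwv, hw⟩ := ih (by omega)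
    have hlt : w < v := lt_of_le_of_ne hwv fun hc => by subst hc; omega
    obtain ⟨x, -, hwx, hxv, hx⟩ := exists_edge_of_lt hlt
    exact ⟨x, huw.trans hwx, hxv, by omega⟩

/-- A vertex above `s` is the end of an edge that stays above `s`. -/
theorem exists_edge_to {s x : Vertex D n} (h : s < x) : ∃ w, IsEdge w x ∧ s ≤ w := by
  have hw := weight_strictMono h
  obtain ⟨w, hsw, hwx, hww⟩ := exists_weight_eq h.le (m := weight x - 1) (by omega) (by omega)
  have hlt : w < x := lt_of_le_of_ne hwx fun hc => by subst hc; omega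
  obtain ⟨y, hy, -, hyx, hyw⟩ := exists_edge_of_lt hlt
  obtain rfl := eq_of_le_of_weight_le hyx (by omega)
  exact ⟨w, hy, hsw⟩

/-- Every vertex other than `s` has an incoming edge inside `[s, t]`, so sending an edge to its
endpoint covers `V`. -/
theorem card_le_card_edgesBelow {s t : Vertex D n} {w : ℕ} (V : Finset (Vertex D n))
    (hV : ∀ x ∈ V, s < x ∧ x ≤ t ∧ weight x ≤ w) : V.card ≤ (edgesBelow s t w).card := by
  refine Finset.card_le_card_of_surjOn (fun e => e.1.2) fun x hx => ?_
  obtain ⟨h1, h2, h3⟩ := hV x hx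
  obtain ⟨y, hy, hsy⟩ := exists_edge_to h1
  exact ⟨⟨(y, x), hy⟩, by simp [edgesBelow, hsy, h2, h3], rfl⟩

theorem mem_layer {s t v : Vertex D n} {w : ℕ} :
    v ∈ layer s t w ↔ s ≤ v ∧ v ≤ t ∧ weight v = weight s + w := by simp [layer]

theorem mem_layerBelow {s v u : Vertex D n} {w : ℕ} :
    u ∈ layerBelow s v w ↔ s ≤ u ∧ u < v ∧ weight u = weight s + w := by simp [layerBelow]

theorem card_mid_layer_le_card_edgesBelow {s t : Vertex D n} (h : s < t) :
    (layer s t ((weight t - weight s) / 2)).card ≤ (edgesBelow s t (weight t)).card := by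
  have hw := weight_strictMono h
  -- If the middle layer is the bottom one it is just `{s}`, which has no incoming edge; the edge
  -- into `t` pays for it.
  rcases Nat.eq_zero_or_pos ((weight t - weight s) / 2) with h0 | h0
  · have h1 : (layer s t ((weight t - weight s) / 2)).card ≤ ({t} : Finset (Vertex D n)).card := by
      rw [Finset.card_singleton, Finset.card_le_one_iff]
      intro a b ha hb
      rw [mem_layer, h0] at ha hb
      rw [← eq_of_le_of_weight_le ha.1 (by omega), ← eq_of_le_of_weight_le hb.1 (by omega)]
    exact h1.trans (card_le_card_edgesBelow _ fun x hx => by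
      rw [Finset.mem_singleton] at hx; subst hx; exact ⟨h, le_rfl, le_rfl⟩)
  · refine card_le_card_edgesBelow _ fun x hx => ?_
    rw [mem_layer] at hx
    exact ⟨lt_of_le_of_ne hx.1 fun hc => by subst hc; omega, hx.2.1, weight_mono hx.2.1⟩

end Geometry


/-! ### Symmetric unimodal sequences and their convolutions -/

section Unimodal

/-- `f` is symmetric about `c / 2` and decreases with the distance to `c / 2`. -/
def SymmUnimodal (f : ℤ → ℝ) (c : ℤ) : Prop :=
  ∀ x y, |2 * x - c| ≤ |2 * y - c| → f y ≤ f x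

theorem SymmUnimodal.reflect {f : ℤ → ℝ} {c : ℤ} (hf : SymmUnimodal f c) (x : ℤ) :
    f (c - x) = f x := by
  have h : |2 * (c - x) - c| = |2 * x - c| := by
    rw [← abs_neg (2 * x - c)]; congr 1; ring
  exact le_antisymm (hf _ _ h.ge) (hf _ _ h.le)

theorem symmUnimodal_of_reflect_of_step {f : ℤ → ℝ} {c : ℤ} (hr : ∀ x, f (c - x) = f x)
    (hs : ∀ x, c ≤ 2 * x + 1 → f (x + 1) ≤ f x) : SymmUnimodal f c := by
  have anti : ∀ x y, c ≤ 2 * x + 1 → x ≤ y → f y ≤ f x := by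
    intro x y hx hxy
    induction y, hxy using Int.leInduction with
    | base => exact le_rfl
    | succ z hz ih => exact (hs z (by omega)).trans ih
  have fold : ∀ x, ∃ x', f x' = f x ∧ |2 * x - c| = 2 * x' - c := by
    intro x
    rcases le_total c (2 * x) with h | h
    · exact ⟨x, rfl, abs_of_nonneg (by omega)⟩
    · exact ⟨c - x, hr x, by rw [abs_of_nonpos (by omega)]; ring⟩
  intro x y hxy
  obtain ⟨x', hx, hx'⟩ := fold x
  obtain ⟨y', hy, hy'⟩ := fold y
  have := abs_nonneg (2 * x - c)
  rw [← hx, ← hy]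
  exact anti x' y' (by omega) (by omega)

theorem sum_Icc_eq_of_support {q : ℤ → ℝ} {d : ℤ} (hq : SymmUnimodal q d)
    (h0 : ∀ j < 0, q j = 0) (f : ℤ → ℝ) {a b : ℤ} (ha : a ≤ 0) (hb : d ≤ b) :
    ∑ j ∈ Finset.Icc 0 d, q j * f j = ∑ j ∈ Finset.Icc a b, q j * f j := by
  refine Finset.sum_subset (Finset.Icc_subset_Icc ha hb) fun j _ hj => ?_
  rw [Finset.mem_Icc, not_and_or, not_le, not_le] at hj
  rcases hj with hj | hj
  · rw [h0 j hj, zero_mul]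
  · rw [← hq.reflect, h0 _ (by omega), zero_mul]

/-- Convolution preserves symmetric unimodality. -/
theorem SymmUnimodal.conv {q f : ℤ → ℝ} {d c : ℤ} (hq : SymmUnimodal q d)
    (h0 : ∀ j < 0, q j = 0) (hf : SymmUnimodal f c) :
    SymmUnimodal (fun m => ∑ j ∈ Finset.Icc 0 d, q j * f (m - j)) (d + c) := by
  refine symmUnimodal_of_reflect_of_step (fun x => ?_) fun x hx => ?_
  · refine Finset.sum_nbij' (fun j => d - j) (fun j => d - j) ?_ ?_ ?_ ?_ ?_
    · intro j hj; rw [Finset.mem_Icc] at hj ⊢; omega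
    · intro j hj; rw [Finset.mem_Icc] at hj ⊢; omega
    · intro j _; ring
    · intro j _; ring
    · intro j _
      rw [hq.reflect, ← hf.reflect]
      congr 2
      ring
  -- By the symmetry of `f`, the substitution `j ↦ b - j` interchanges `f (x - j)` and `f (x + 1 -
  -- j)`. The summation range is widened so that it is invariant under it.
  · set b : ℤ := 2 * x + 1 - c with hb
    rw [← sub_nonneg]
    have e1 := sum_Icc_eq_of_support hq h0 (fun j => f (x - j))
      (a := b - max b d) (b := max b d) (by simp) (le_max_right _ _)
    have e2 := sum_Icc_eq_of_support hq h0 (fun j => f (x + 1 - j))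
      (a := b - max b d) (b := max b d) (by simp) (le_max_right _ _)
    simp only [e1, e2]
    rw [← Finset.sum_sub_distrib]
    have key : ∑ j ∈ Finset.Icc (b - max b d) (max b d),
          (q j * f (x - j) - q j * f (x + 1 - j)) =
        ∑ j ∈ Finset.Icc (b - max b d) (max b d),
          (q (b - j) * f (x + 1 - j) - q (b - j) * f (x - j)) := by
      refine Finset.sum_nbij' (fun j => b - j) (fun j => b - j) ?_ ?_ ?_ ?_ ?_
      · intro j hj; rw [Finset.mem_Icc] at hj ⊢; omega
      · intro j hj; rw [Finset.mem_Icc] at hj ⊢; omega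
      · intro j _; ring
      · intro j _; ring
      · intro j _
        have h1 : x + 1 - (b - j) = c - (x - j) := by rw [hb]; ring
        have h2 : x - (b - j) = c - (x + 1 - j) := by rw [hb]; ring
        rw [h1, h2, hf.reflect, hf.reflect, sub_sub_cancel]
    -- Twice the difference is a sum of products `(q j - q (b - j)) * (f (x - j) - f (x + 1 - j))`,
    -- and both factors switch sign at `2 * j = b`; for `q` this uses `d ≤ b`.
    have pos : 0 ≤ ∑ j ∈ Finset.Icc (b - max b d) (max b d),
        ((q j * f (x - j) - q j * f (x + 1 - j)) +
          (q (b - j) * f (x + 1 - j) - q (b - j) * f (x - j))) := by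
      refine Finset.sum_nonneg fun j _ => ?_
      have hfac : (q j * f (x - j) - q j * f (x + 1 - j)) +
          (q (b - j) * f (x + 1 - j) - q (b - j) * f (x - j)) =
          (q j - q (b - j)) * (f (x - j) - f (x + 1 - j)) := by ring
      rw [hfac]
      rcases le_total (2 * j) b with h | h
      · refine mul_nonneg (sub_nonneg.2 (hq _ _ ?_)) (sub_nonneg.2 (hf _ _ ?_)) <;>
          rw [← sq_le_sq] <;> nlinarith
      · refine mul_nonneg_of_nonpos_of_nonpos (sub_nonpos.2 (hq _ _ ?_))
          (sub_nonpos.2 (hf _ _ ?_)) <;>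
          rw [← sq_le_sq] <;> nlinarith
    rw [Finset.sum_add_distrib, ← key] at pos
    linarith

/-- The sum of `∏ i, q i (x i)` over the vertices `x` of weight `m`. -/
noncomputable def layerSum (D : ℕ) {n : ℕ} (q : Fin n → ℤ → ℝ) (m : ℤ) : ℝ :=
  ∑ x : Vertex D n, if (weight x : ℤ) = m then ∏ i, q i (x i : ℕ) else 0

theorem weight_cons {D n : ℕ} (a : Fin (D + 1)) (x : Vertex D n) :
    weight (Fin.cons a x : Vertex D (n + 1)) = a + weight x := by
  simp [weight, Fin.sum_univ_succ]

theorem layerSum_succ (D : ℕ) {n : ℕ} (q : Fin (n + 1) → ℤ → ℝ) (m : ℤ) :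
    layerSum D q m =
      ∑ j ∈ Finset.Icc (0 : ℤ) D, q 0 j * layerSum D (fun i => q i.succ) (m - j) := by
  have h1 : layerSum D q m =
      ∑ a : Fin (D + 1), q 0 (a : ℕ) * layerSum D (fun i => q i.succ) (m - (a : ℕ)) := by
    unfold layerSum
    rw [← (Fin.consEquiv fun _ => Fin (D + 1)).sum_comp, Fintype.sum_prod_type]
    refine Finset.sum_congr rfl fun a _ => ?_
    rw [Finset.mul_sum]
    refine Finset.sum_congr rfl fun x _ => ?_
    have hw : weight ((Fin.consEquiv fun _ => Fin (D + 1)) (a, x)) = a + weight x :=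
      weight_cons a x
    rw [hw, mul_ite, mul_zero, Fin.prod_univ_succ]
    refine if_congr ⟨fun h => ?_, fun h => ?_⟩ rfl rfl
    · push_cast at h; omega
    · push_cast; omega
  rw [h1]
  refine Finset.sum_nbij (fun a => ((a : ℕ) : ℤ)) ?_ ?_ ?_ fun _ _ => rfl
  · intro a _; rw [Finset.mem_Icc]; have := a.isLt; omega
  · intro a _ b _ hab
    have h : ((a : ℕ) : ℤ) = (b : ℕ) := hab
    exact Fin.ext (by exact_mod_cast h)
  · intro j hj
    rw [Finset.mem_coe, Finset.mem_Icc] at hj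
    exact ⟨⟨j.toNat, by omega⟩, by simp, by simp [hj.1]⟩

/-- Each coordinate contributes one convolution, starting from the point mass at `0` for `n = 0`. -/
theorem symmUnimodal_layerSum (D : ℕ) {n : ℕ} (q : Fin n → ℤ → ℝ) (d : Fin n → ℤ)
    (hd : ∀ i, d i ≤ D) (h0 : ∀ i, ∀ j < 0, q i j = 0) (hq : ∀ i, SymmUnimodal (q i) (d i)) :
    SymmUnimodal (layerSum D q) (∑ i, d i) := by
  induction n with
  | zero =>
    intro x y hxy
    have h : ∀ z, layerSum D q z = if 0 = z then 1 else 0 := by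
      intro z; simp [layerSum, weight]
    rw [h, h]
    simp only [Finset.univ_eq_empty, Finset.sum_empty, sub_zero] at hxy
    split_ifs with h1 h2 h2
    · exact le_rfl
    · subst h1
      rw [mul_zero, abs_zero, abs_nonpos_iff] at hxy
      omega
    · exact zero_le_one
    · exact le_rfl
  | succ n ih =>
    have h := (hq 0).conv (h0 0) (ih (fun i => q i.succ) (fun i => d i.succ)
      (fun i => hd _) (fun i => h0 _) fun i => hq _)
    rw [Fin.sum_univ_succ]
    convert h using 1
    funext m
    rw [layerSum_succ]
    exact (sum_Icc_eq_of_support (hq 0) (h0 0) (fun j => layerSum D (fun i => q i.succ) (m - j))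
      le_rfl (hd 0)).symm

theorem symmUnimodal_indicator (d : ℤ) :
    SymmUnimodal (fun j => if 0 ≤ j ∧ j ≤ d then 1 else 0) d := by
  intro x y hxy
  dsimp only
  split_ifs with h1 h2 h2
  · exact le_rfl
  · exfalso
    rcases abs_cases (2 * x - d) with h | h <;> rcases abs_cases (2 * y - d) with h' | h' <;> omega
  · exact zero_le_one
  · exact le_rfl

/-- The product `j * (d - j)` depends only on the distance of `j` to `d / 2` and decreases with it,
and rounding is monotone. -/
theorem symmUnimodal_mul_div (d : ℤ) :
    SymmUnimodal (fun j => if 0 ≤ j ∧ j ≤ d then ((j * (d - j) / d + 1 : ℤ) : ℝ) else 0) d := by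
  intro x y hxy
  dsimp only
  split_ifs with h1 h2 h2
  · rw [← sq_le_sq] at hxy
    have h3 : y * (d - y) / d ≤ x * (d - x) / d := by
      rcases (h1.1.trans h1.2).eq_or_lt with h0 | h0
      · rw [← h0, Int.ediv_zero, Int.ediv_zero]
      · exact Int.ediv_le_ediv h0 (by nlinarith)
    exact_mod_cast (by omega : y * (d - y) / d + 1 ≤ x * (d - x) / d + 1)
  · exfalso
    rcases abs_cases (2 * x - d) with h | h <;> rcases abs_cases (2 * y - d) with h' | h' <;> omega
  · have : 0 ≤ x * (d - x) / d :=
      Int.ediv_nonneg (mul_nonneg h2.1 (by omega)) (by omega)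
    exact_mod_cast (by omega : 0 ≤ x * (d - x) / d + 1)
  · exact le_rfl

end Unimodal


/-! ### Counting pairs of comparable vertices in two layers -/

section Counting

variable {D n : ℕ}

/-- The vertex `0^n`. -/
abbrev bot (D n : ℕ) : Vertex D n := fun _ => 0

/-- The vertex `D^n`. -/
abbrev top (D n : ℕ) : Vertex D n := fun _ => Fin.last D

theorem weight_bot : weight (bot D n) = 0 := by simp [weight]

theorem weight_top : weight (top D n) = n * D := by simp [weight]

theorem bot_le (v : Vertex D n) : bot D n ≤ v := fun _ => Fin.zero_le _

theorem le_top (v : Vertex D n) : v ≤ top D n := fun i => Fin.le_last (v i)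

theorem mem_layer_bot {v w : Vertex D n} {m : ℕ} :
    w ∈ layer (bot D n) v m ↔ w ≤ v ∧ weight w = m := by
  rw [mem_layer, weight_bot, zero_add]
  exact ⟨fun h => h.2, fun h => ⟨bot_le w, h⟩⟩

/-- By the symmetry `w ↦ b - w`, at least half of the vertices below `b` have weight at most
`|b| / 2`. -/
theorem prod_le_two_mul_card (b : Vertex D n) {m : ℕ} (hb : weight b ≤ 2 * m + 1) :
    ∏ i, ((b i : ℕ) + 1) ≤ 2 * ((Finset.Iic b).filter fun w => weight w ≤ m).card := by
  have hcard : (Finset.Iic b).card = ∏ i, ((b i : ℕ) + 1) := by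
    rw [Pi.card_Iic]; simp
  rw [← hcard, ← Finset.card_filter_add_card_filter_not (s := Finset.Iic b)
    (fun w => weight w ≤ m), two_mul]
  refine Nat.add_le_add_left ?_ _
  refine Finset.card_le_card_of_injOn (fun w i => b i - w i) ?_ ?_
  · intro w hw
    simp only [Finset.coe_filter, Finset.mem_Iic, Set.mem_ofPred_eq, not_le] at hw ⊢
    have hv : ∀ i, ((b i - w i : Fin (D + 1)) : ℕ) = (b i : ℕ) - (w i : ℕ) :=
      fun i => Fin.sub_val_of_le (hw.1 i)
    refine ⟨fun i => Fin.le_def.2 (by rw [hv]; omega), ?_⟩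
    have hsum : weight (fun i => b i - w i) = weight b - weight w := by
      unfold weight
      rw [← Finset.sum_tsub_distrib _ fun i _ => Fin.le_def.1 (hw.1 i)]
      exact Finset.sum_congr rfl fun i _ => hv i
    omega
  · intro w hw w' hw' h
    funext i
    exact sub_right_injective (congrFun h i)

theorem card_layer_bot_eq_layerSum (v : Vertex D n) (m : ℕ) :
    ((layer (bot D n) v m).card : ℝ) =
      layerSum D (fun i j => if 0 ≤ j ∧ j ≤ ((v i : ℕ) : ℤ) then 1 else 0) m := by
  classical
  have h : layer (bot D n) v m =
      Finset.univ.filter fun w => weight w = m ∧ w ≤ v := by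
    ext w
    rw [mem_layer_bot, and_comm]
    simp
  rw [h, Finset.card_filter, layerSum, Nat.cast_sum]
  refine Finset.sum_congr rfl fun w _ => ?_
  rw [Finset.prod_boole]
  have hle : (∀ i ∈ Finset.univ, 0 ≤ ((w i : ℕ) : ℤ) ∧ ((w i : ℕ) : ℤ) ≤ ((v i : ℕ) : ℤ)) ↔
      w ≤ v :=
    ⟨fun h i => Fin.le_def.2 (Nat.cast_le.1 (h i (Finset.mem_univ i)).2),
      fun h i _ => ⟨Nat.cast_nonneg _, Nat.cast_le.2 (h i)⟩⟩
  by_cases h1 : weight w = m <;> by_cases h2 : w ≤ v <;> simp only [h1, h2, hle] <;> simp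
  exact_mod_cast h1

/-- Since `m ≤ M ≤ |v| - m`, layer `M` is at least as close to the middle of `[0, v]` as layer `m`.
-/
theorem card_layer_bot_le {v : Vertex D n} {m M : ℕ} (h1 : m ≤ M) (h2 : M + m ≤ weight v) :
    (layer (bot D n) v m).card ≤ (layer (bot D n) v M).card := by
  have h := symmUnimodal_layerSum D (fun i j => if 0 ≤ j ∧ j ≤ ((v i : ℕ) : ℤ) then 1 else 0)
    (fun i => ((v i : ℕ) : ℤ)) (fun i => by have := (v i).isLt; omega)
    (fun i j hj => if_neg (by omega)) fun i => symmUnimodal_indicator _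
  have hs : ∑ i, ((v i : ℕ) : ℤ) = (weight v : ℕ) := by simp [weight]
  rw [hs] at h
  have h3 := h M m (by
    rcases abs_cases (2 * (M : ℤ) - weight v) with h | h <;>
      rcases abs_cases (2 * (m : ℤ) - weight v) with h' | h' <;> omega)
  rw [← card_layer_bot_eq_layerSum, ← card_layer_bot_eq_layerSum] at h3
  exact_mod_cast h3

/-- Half of the box below `b` lies in the `m + 1` lowest layers of `[0, v]`, none of which is larger
than layer `M`. -/
theorem prod_le_mul_card_layer_bot {b v : Vertex D n} (hbv : b ≤ v) {m M : ℕ}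
    (hb : weight b ≤ 2 * m + 1) (h1 : m ≤ M) (h2 : M + m ≤ weight v) :
    ∏ i, ((b i : ℕ) + 1) ≤ 2 * (m + 1) * (layer (bot D n) v M).card := by
  classical
  refine (prod_le_two_mul_card b hb).trans ?_
  rw [mul_assoc]
  refine Nat.mul_le_mul_left 2 ?_
  have hsub : ((Finset.Iic b).filter fun w => weight w ≤ m) ⊆
      (Finset.range (m + 1)).biUnion fun j => layer (bot D n) v j := by
    intro w hw
    rw [Finset.mem_filter, Finset.mem_Iic] at hw
    rw [Finset.mem_biUnion]
    exact ⟨weight w, Finset.mem_range.2 (by omega), mem_layer_bot.2 ⟨hw.1.trans hbv, rfl⟩⟩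
  refine (Finset.card_le_card hsub).trans ?_
  have h := Finset.card_biUnion_le_card_mul (Finset.range (m + 1))
    (fun j => layer (bot D n) v j) (layer (bot D n) v M).card fun j hj => by
      rw [Finset.mem_range] at hj
      exact card_layer_bot_le (by omega) (by omega)
  rwa [Finset.card_range] at h

theorem mul_sub_div_le (D j : ℕ) : 4 * (j * (D - j) / D) ≤ D := by
  rcases Nat.eq_zero_or_pos D with h | h
  · subst h; simp
  · have h1 : j * (D - j) / D * D ≤ j * (D - j) := Nat.div_mul_le_self _ _
    have h2 : 4 * (j * (D - j)) ≤ D * D := by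
      rcases le_total j D with h | h
      · obtain ⟨k, rfl⟩ := Nat.exists_eq_add_of_le h
        rw [Nat.add_sub_cancel_left]
        zify
        nlinarith [sq_nonneg ((j : ℤ) - k)]
      · rw [Nat.sub_eq_zero_of_le h]; simp
    refine Nat.le_of_mul_le_mul_right ?_ h
    linarith

theorem mul_sub_div_le_self (D j : ℕ) : j * (D - j) / D ≤ j := by
  refine Nat.div_le_of_le_mul ?_
  rw [mul_comm D]
  exact Nat.mul_le_mul_left _ (Nat.sub_le _ _)

/-- The power expands into the sum of the product weight over all vertices. These fall into `n * D +
1` layers, and the middle one has the largest sum. -/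
theorem pow_sum_le_mul_sum_layer (D n : ℕ) :
    (∑ j : Fin (D + 1), ((j : ℕ) * (D - j) / D + 1)) ^ n ≤
      (n * D + 1) * ∑ v ∈ layer (bot D n) (top D n) (n * D / 2),
        ∏ i, ((v i : ℕ) * (D - v i) / D + 1) := by
  set q : ℤ → ℝ := fun j => if 0 ≤ j ∧ j ≤ (D : ℤ) then
    ((j * ((D : ℤ) - j) / D + 1 : ℤ) : ℝ) else 0 with hq
  have hqv : ∀ j : Fin (D + 1), q (j : ℕ) = (((j : ℕ) * (D - j) / D + 1 : ℕ) : ℝ) := by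
    intro j
    have hj : (j : ℕ) ≤ D := Nat.lt_succ_iff.1 j.isLt
    rw [hq]
    dsimp only
    rw [if_pos ⟨by omega, by omega⟩, ← Nat.cast_sub hj]
    norm_cast
  have hu := symmUnimodal_layerSum D (fun _ : Fin n => q) (fun _ => (D : ℤ)) (fun _ => le_rfl)
    (fun _ j hj => if_neg (by omega)) fun _ => symmUnimodal_mul_div _
  rw [Finset.sum_const, Finset.card_univ, Fintype.card_fin, nsmul_eq_mul] at hu
  have hmid : layerSum D (fun _ : Fin n => q) ((n * D / 2 : ℕ) : ℤ) =
      ((∑ v ∈ layer (bot D n) (top D n) (n * D / 2),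
        ∏ i, ((v i : ℕ) * (D - v i) / D + 1) : ℕ) : ℝ) := by
    have hl : layer (bot D n) (top D n) (n * D / 2) =
        Finset.univ.filter fun v => weight v = n * D / 2 := by
      ext v
      rw [mem_layer_bot]
      simp [le_top v]
    rw [hl, Finset.sum_filter, layerSum, Nat.cast_sum]
    refine Finset.sum_congr rfl fun v _ => ?_
    rw [Nat.cast_ite, Nat.cast_prod, Nat.cast_zero]
    refine if_congr Nat.cast_inj (Finset.prod_congr rfl fun i _ => hqv (v i)) rfl
  have htot : (((∑ j : Fin (D + 1), ((j : ℕ) * (D - j) / D + 1)) ^ n : ℕ) : ℝ) =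
      ∑ m ∈ Finset.range (n * D + 1), layerSum D (fun _ : Fin n => q) (m : ℤ) := by
    unfold layerSum
    rw [Finset.sum_comm]
    have h1 : ∀ v : Vertex D n, (∑ m ∈ Finset.range (n * D + 1),
        if (weight v : ℤ) = (m : ℤ) then ∏ i, q (v i : ℕ) else 0) = ∏ i, q (v i : ℕ) := by
      intro v
      have hv : weight v ≤ n * D := weight_top (D := D) (n := n) ▸ weight_mono (le_top v)
      rw [Finset.sum_eq_single (weight v)]
      · simp
      · intro m _ hm
        rw [if_neg (by exact_mod_cast hm.symm)]
      · intro h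
        exact absurd (Finset.mem_range.2 (by omega)) h
    rw [Finset.sum_congr rfl fun v _ => h1 v, Nat.cast_pow, Nat.cast_sum]
    have h2 := (Finset.prod_univ_sum (fun _ : Fin n => (Finset.univ : Finset (Fin (D + 1))))
      fun _ j => q (j : ℕ))
    rw [Fintype.piFinset_univ] at h2
    rw [← h2, Finset.prod_const, Finset.card_univ, Fintype.card_fin]
    congr 1
    exact Finset.sum_congr rfl fun j _ => (hqv j).symm
  have hle : ∑ m ∈ Finset.range (n * D + 1), layerSum D (fun _ : Fin n => q) (m : ℤ) ≤
      ((n * D + 1 : ℕ) : ℝ) * layerSum D (fun _ : Fin n => q) ((n * D / 2 : ℕ) : ℤ) := by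
    have h := Finset.sum_le_card_nsmul (Finset.range (n * D + 1))
      (fun m => layerSum D (fun _ : Fin n => q) (m : ℤ))
      (layerSum D (fun _ : Fin n => q) ((n * D / 2 : ℕ) : ℤ)) fun m _ => hu _ _ (by
        rw [← Nat.cast_mul]
        generalize n * D = N
        rcases abs_cases (2 * ((N / 2 : ℕ) : ℤ) - (N : ℕ)) with h | h <;>
          rcases abs_cases (2 * (m : ℤ) - (N : ℕ)) with h' | h' <;> omega)
    rwa [Finset.card_range, nsmul_eq_mul] at h
  rw [← htot, hmid] at hle
  exact_mod_cast hle

/-- The box corner `b_i = ⌊v_i (D - v_i) / D⌋` lies below `v` and has coordinates at most `D / 4`,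
so one cutoff `n * D / 8` serves all `v`. -/
theorem pow_sum_le_mul_sum_card_layer (D n : ℕ) {M : ℕ} (h1 : n * D / 8 ≤ M)
    (h2 : M + n * D / 8 ≤ n * D / 2) :
    (∑ j : Fin (D + 1), ((j : ℕ) * (D - j) / D + 1)) ^ n ≤
      (n * D + 1) * (2 * (n * D / 8 + 1)) *
        ∑ v ∈ layer (bot D n) (top D n) (n * D / 2), (layer (bot D n) v M).card := by
  refine (pow_sum_le_mul_sum_layer D n).trans ?_
  rw [mul_assoc]
  refine Nat.mul_le_mul_left _ ?_
  rw [Finset.mul_sum]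
  refine Finset.sum_le_sum fun v hv => ?_
  rw [mem_layer_bot] at hv
  have hlt : ∀ i, (v i : ℕ) * (D - v i) / D < D + 1 := fun i =>
    (mul_sub_div_le_self D (v i)).trans_lt (v i).isLt
  refine prod_le_mul_card_layer_bot (b := fun i => ⟨_, hlt i⟩)
    (fun i => Fin.le_def.2 (mul_sub_div_le_self D (v i))) ?_ h1 (by omega)
  have h4 : 4 * weight (fun i => (⟨_, hlt i⟩ : Fin (D + 1))) ≤ n * D := by
    unfold weight
    rw [Finset.mul_sum]
    refine (Finset.sum_le_card_nsmul _ _ D fun i _ => mul_sub_div_le D (v i)).trans ?_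
    simp
  omega

theorem sq_div_exp_le_sum {D : ℕ} (hD : 1 ≤ D) :
    (((D : ℝ) + 1) / Real.exp 1) ^ 2 ≤
      ((∑ j : Fin (D + 1), ((j : ℕ) * (D - j) / D + 1) : ℕ) : ℝ) := by
  have hD' : (1 : ℝ) ≤ D := by exact_mod_cast hD
  -- For integers, `⌊a / D⌋ + 1 ≥ (a + 1) / D`; the extra `1` matters for small `D`.
  have hterm : ∀ j ∈ Finset.range (D + 1), ((j : ℝ) * (D - j) + 1) / D ≤
      ((j * (D - j) / D + 1 : ℕ) : ℝ) := by
    intro j hj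
    have hj' : j ≤ D := Nat.lt_succ_iff.1 (Finset.mem_range.1 hj)
    rw [div_le_iff₀ (by linarith), ← Nat.cast_sub hj']
    have := Nat.lt_div_mul_add (a := j * (D - j)) (b := D) (by omega)
    have h : j * (D - j) + 1 ≤ (j * (D - j) / D + 1) * D := by rw [add_mul]; omega
    exact_mod_cast h
  have hsum : ∀ m : ℕ, ∑ j ∈ Finset.range (m + 1), ((j : ℝ) * (D - j) + 1) =
      D * (m * (m + 1) / 2) - m * (m + 1) * (2 * m + 1) / 6 + (m + 1) := by
    intro m
    induction m with
    | zero => simp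
    | succ m ih => rw [Finset.sum_range_succ, ih]; push_cast; ring
  rw [Fin.sum_univ_eq_sum_range (fun j => j * (D - j) / D + 1), Nat.cast_sum]
  refine le_trans ?_ (Finset.sum_le_sum hterm)
  rw [← Finset.sum_div, hsum, div_pow, div_le_div_iff₀ (by positivity) (by linarith)]
  -- A rational lower bound for `e ^ 2`, large enough to make the quadratic in `h2` positive for
  -- every `D`.
  have he : 7.38 ≤ Real.exp 1 ^ 2 := by
    have := Real.exp_one_gt_d9
    nlinarith
  have hS : ((D : ℝ) + 1) ^ 2 * D ≤ (D * (D * (D + 1) / 2) - D * (D + 1) * (2 * D + 1) / 6 +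
      (D + 1)) * 7.38 := by
    have : (D * ((D : ℝ) * (D + 1) / 2) - D * (D + 1) * (2 * D + 1) / 6 + (D + 1)) * 7.38 -
        ((D : ℝ) + 1) ^ 2 * D = (D + 1) * (0.23 * D ^ 2 - 2.23 * D + 7.38) := by ring
    have h2 : 0 ≤ 0.23 * (D : ℝ) ^ 2 - 2.23 * D + 7.38 := by
      nlinarith [sq_nonneg ((D : ℝ) - 4.85)]
    have := mul_nonneg (by linarith : (0 : ℝ) ≤ D + 1) h2
    linarith
  refine hS.trans (mul_le_mul_of_nonneg_left he ?_)
  have : (0 : ℝ) ≤ ((D : ℝ) + 1) ^ 2 * D := by positivity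
  linarith

end Counting


/-! ### From the recursion to layer sizes -/

section LowerBound

variable {D n K : ℕ} {α : ℕ → ℕ → ℝ} {κ : ℝ}

theorem layerWeight_succ_self (K : ℕ) (α : ℕ → ℕ → ℝ) (s t : Vertex D n) :
    layerWeight K α s t (K + 1) = (weight t - weight s) / 2 := by
  simp [layerWeight]

theorem layerWeight_le_succ (hα : Admissible D K α) {s t : Vertex D n} (h : s ≤ t) {k : ℕ}
    (hk : 1 ≤ k) (hkK : k ≤ K) : layerWeight K α s t k ≤ layerWeight K α s t (k + 1) := by
  rcases hkK.lt_or_eq with hlt | rfl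
  · rw [layerWeight, layerWeight, if_pos hkK, if_pos (show k + 1 ≤ K from hlt)]
    refine Nat.floor_mono (Finset.sum_le_sum fun d hd => ?_)
    exact mul_le_mul_of_nonneg_right (mul_le_mul_of_nonneg_right (hα.lt_succ k hk hlt d hd).le
      (Nat.cast_nonneg _)) (Nat.cast_nonneg _)
  · rw [layerWeight_succ_self]
    exact layerWeight_le_half hα h hk

/-- The queries of `Path(s, t)`: either all edges of `[s, t]` are queried, or the layer weights
increase strictly and the precalculation is followed by the VTS over the middle layer. -/
theorem queries_path_cases (hK : 1 ≤ K) (hα : Admissible D K α) (κ : ℝ)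
    (G : Subgraph D n) {s t : Vertex D n} (h : s ≤ t) :
    ((edgesBelow s t (weight t)).card : ℝ) ≤ (path K α s t).queries κ G ∨
    (∀ k, 1 ≤ k → k ≤ K → layerWeight K α s t k < layerWeight K α s t (k + 1)) ∧
    ∃ dp dp' : Vertex D n → Bool,
      (edgesBelow s t (weight s + layerWeight K α s t 1)).card +
        (QAlg.vts (layer s t ((weight t - weight s) / 2)) (fun v =>
          (layerPath (path K α) (layerWeight K α s t) s dp (K + 1) v.1).both
            (layerPath' (path K α) (layerWeight K α s t) t dp' (K + 1) v.1))
          .ret).queries κ G ≤ (path K α s t).queries κ G := by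
  rw [path_eq hK hα h]
  unfold pathBody
  dsimp only
  split_ifs with hW
  · left
    obtain ⟨T, hT⟩ := QAlg.exists_queries_queryAll κ G (edgesBelow s t (weight t)) _
    rw [hT]
    simp [QAlg.queries]
  · right
    refine ⟨fun k hk hkK => lt_of_le_of_ne (layerWeight_le_succ hα h hk hkK)
      fun hc => hW ⟨k, Finset.mem_Icc.2 ⟨hk, hkK⟩, hc⟩, ?_⟩
    obtain ⟨T, hT⟩ := QAlg.exists_queries_queryAll κ G
      (edgesBelow s t (weight s + layerWeight K α s t 1)) _
    rw [hT]
    obtain ⟨T', hT'⟩ := QAlg.exists_queries_queryAll κ G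
      (edgesAbove s t (weight t - layerWeight K α s t 1)) _
    rw [hT', layerWeight_succ_self]
    refine ⟨_, _, add_le_add_right (le_add_of_nonneg_left (Nat.cast_nonneg _)) _⟩

/-- Costs are nonnegative, so for each `u` a bound on either the inner `LayerPath` call or the
recursive `Path` call suffices. -/
theorem mul_sum_le_sq_queries_layerPath (hκ : 0 < κ) (G : Subgraph D n)
    (P : Vertex D n → Vertex D n → LatticeAlg D n) (W : ℕ → ℕ) (s : Vertex D n)
    (dp : Vertex D n → Bool) {k : ℕ} (hk : 1 ≤ k) (v : Vertex D n) (g : Vertex D n → ℝ)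
    (hg : ∀ u ∈ layerBelow s v (W k), g u ≤ (layerPath P W s dp k u).queries κ G ^ 2 ∨
      g u ≤ (P u v).queries κ G ^ 2) :
    κ ^ 2 * ∑ u ∈ layerBelow s v (W k), g u ≤
      (layerPath P W s dp (k + 1) v).queries κ G ^ 2 := by
  obtain ⟨k, rfl⟩ := Nat.exists_eq_add_of_le' hk
  rw [layerPath]
  refine QAlg.mul_sum_le_sq_queries_vts G _ _ g fun u => ?_
  rw [QAlg.queries_both]
  have h1 := QAlg.queries_nonneg hκ.le G (layerPath P W s dp (k + 1) u.1)
  have h2 := QAlg.queries_nonneg hκ.le G (P u.1 v)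
  rcases hg u.1 u.2 with h | h <;> nlinarith

theorem mul_sum_le_sq_queries_mid (hκ : 0 < κ) (G : Subgraph D n) (S : Finset (Vertex D n))
    (A B : {x // x ∈ S} → LatticeAlg D n) (g : Vertex D n → ℝ)
    (hg : ∀ v, g v.1 ≤ (A v).queries κ G ^ 2) :
    κ ^ 2 * ∑ v ∈ S, g v ≤ ((QAlg.vts S (fun v => (A v).both (B v)) .ret).queries κ G) ^ 2 := by
  refine QAlg.mul_sum_le_sq_queries_vts G _ _ g fun v => (hg v).trans ?_
  rw [QAlg.queries_both]
  have h1 := QAlg.queries_nonneg hκ.le G (A v)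
  have h2 := QAlg.queries_nonneg hκ.le G (B v)
  nlinarith

/-- If the recursive calls `Path(u, v)` cost at least `c`, so does `LayerPath(k + 1, v)` up to
the factor `κ`. -/
theorem sq_le_sq_queries_layerPath (hκ : 0 < κ) (G : Subgraph D n)
    (P : Vertex D n → Vertex D n → LatticeAlg D n) {W : ℕ → ℕ} {s v : Vertex D n}
    (dp : Vertex D n → Bool) {k : ℕ} (hk : 1 ≤ k) (hsv : s ≤ v)
    (hW : weight s + W k < weight v) {c : ℝ} (hc : 0 ≤ c)
    (hP : ∀ u, s ≤ u → u < v → c ≤ (P u v).queries κ G) :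
    (κ * c) ^ 2 ≤ (layerPath P W s dp (k + 1) v).queries κ G ^ 2 := by
  refine le_trans ?_ (mul_sum_le_sq_queries_layerPath hκ G P W s dp hk v (fun _ => c ^ 2)
    fun u hu => Or.inr ?_)
  · obtain ⟨u, hsu, huv, hu⟩ := exists_weight_eq hsv (Nat.le_add_right _ (W k)) hW.le
    have hmem : u ∈ layerBelow s v (W k) :=
      mem_layerBelow.2 ⟨hsu, lt_of_le_of_ne huv fun hc => by subst hc; omega, hu⟩
    have hcard : (1 : ℝ) ≤ (layerBelow s v (W k)).card := by
      exact_mod_cast Finset.card_pos.2 ⟨u, hmem⟩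
    rw [mul_pow, Finset.sum_const, nsmul_eq_mul]
    refine mul_le_mul_of_nonneg_left ?_ (sq_nonneg κ)
    nlinarith [sq_nonneg c]
  · rw [mem_layerBelow] at hu
    exact pow_le_pow_left₀ hc (hP u hu.1 hu.2.1) 2

theorem one_le_card_edgesBelow {s t : Vertex D n} (h : s < t) {w : ℕ} (hw : weight s + 1 ≤ w) :
    1 ≤ (edgesBelow s t w).card := by
  have hst := weight_strictMono h
  obtain ⟨x, hsx, hxt, hx⟩ := exists_weight_eq h.le (m := weight s + 1) (by omega) (by omega)
  refine card_le_card_edgesBelow {x} fun y hy => ?_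
  rw [Finset.mem_singleton] at hy
  subst hy
  exact ⟨lt_of_le_of_ne hsx fun hc => by subst hc; omega, hxt, by omega⟩

/-- The middle layer of `[s, t]` is nonempty and `LayerPath(K + 1, v)` makes recursive calls for
each of its vertices `v`. -/
theorem mul_card_mid_layer_le_sq_queries (hK : 1 ≤ K) (hκ : 0 < κ) (G : Subgraph D n)
    {s t : Vertex D n}
    (hW : layerWeight K α s t K < layerWeight K α s t (K + 1)) (dp dp' : Vertex D n → Bool)
    {c : ℝ} (hc : 0 ≤ c)
    (hP : ∀ u v, s ≤ u → u < v → v ≤ t → weight v = weight s + (weight t - weight s) / 2 →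
      c ≤ (path K α u v).queries κ G) :
    κ ^ 2 * ((layer s t ((weight t - weight s) / 2)).card * (κ * c) ^ 2) ≤
      ((QAlg.vts (layer s t ((weight t - weight s) / 2)) (fun v =>
          (layerPath (path K α) (layerWeight K α s t) s dp (K + 1) v.1).both
            (layerPath' (path K α) (layerWeight K α s t) t dp' (K + 1) v.1))
          .ret).queries κ G) ^ 2 := by
  rw [← nsmul_eq_mul, ← Finset.sum_const]
  refine mul_sum_le_sq_queries_mid hκ G _ _ _ _ fun v => ?_
  have hv := mem_layer.1 v.2
  rw [layerWeight_succ_self] at hW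
  exact sq_le_sq_queries_layerPath hκ G _ dp hK hv.1 (by omega) hc
    fun u hu huv => hP u v.1 hu huv hv.2.1 hv.2.2

theorem card_mid_layer_pos {s t : Vertex D n} (h : s ≤ t) :
    1 ≤ (layer s t ((weight t - weight s) / 2)).card := by
  have := weight_mono h
  obtain ⟨x, h1, h2, h3⟩ := exists_weight_eq h
    (m := weight s + (weight t - weight s) / 2) (by omega) (by omega)
  exact Finset.card_pos.2 ⟨x, mem_layer.2 ⟨h1, h2, h3⟩⟩

/-- Each level of recursion loses at most `κ ^ 2`: one factor from the middle VTS and one from the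
last VTS of `LayerPath`. The weight difference bounds the depth. -/
theorem pow_le_queries_path (hK : 1 ≤ K) (hα : Admissible D K α) (hκ : 0 < κ)
    (G : Subgraph D n) (N : ℕ) : ∀ s t : Vertex D n, s < t → weight t - weight s ≤ N →
      min κ 1 ^ (2 * N) ≤ (path K α s t).queries κ G := by
  have hμ0 : 0 < min κ 1 := lt_min hκ one_pos
  induction N with
  | zero =>
    intro s t h hN
    have := weight_strictMono h
    omega
  | succ N ih =>
    intro s t h hN
    have hst := weight_strictMono h
    rcases queries_path_cases hK hα κ G h.le with hq | ⟨hW, dp, dp', hq⟩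
    · refine (pow_le_one₀ hμ0.le (min_le_right _ _)).trans (le_trans ?_ hq)
      exact_mod_cast one_le_card_edgesBelow h hst
    · refine le_trans ?_ ((le_add_of_nonneg_left (Nat.cast_nonneg _)).trans hq)
      have h1 := mul_card_mid_layer_le_sq_queries hK hκ G (hW K hK le_rfl) dp dp'
        (c := min κ 1 ^ (2 * N)) (by positivity) fun u v hu huv hv hvw => ih u v huv (by
          have := weight_mono hu
          omega)
      have hcard : (1 : ℝ) ≤ (layer s t ((weight t - weight s) / 2)).card := by
        exact_mod_cast card_mid_layer_pos h.le
      have h2 : (min κ 1 ^ (2 * (N + 1))) ^ 2 ≤ κ ^ 2 *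
          ((layer s t ((weight t - weight s) / 2)).card * (κ * min κ 1 ^ (2 * N)) ^ 2) := by
        have e : (min κ 1 ^ (2 * (N + 1))) ^ 2 =
            min κ 1 ^ 2 * (1 * (min κ 1 * min κ 1 ^ (2 * N)) ^ 2) := by ring
        rw [e]
        have hle := min_le_left κ 1
        gcongr
      exact (pow_le_pow_iff_left₀ (by positivity) (QAlg.queries_nonneg hκ.le G _)
        two_ne_zero).1 (h2.trans h1)

theorem exists_pos_le_of_finset {ι : Type*} (S : Finset ι) (f : ι → ℝ) (hf : ∀ i ∈ S, 0 < f i) :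
    ∃ a > 0, ∀ i ∈ S, a ≤ f i := by
  rcases S.eq_empty_or_nonempty with rfl | hS
  · exact ⟨1, one_pos, by simp⟩
  · obtain ⟨i, hi, h⟩ := S.exists_min_image f hS
    exact ⟨f i, hf i hi, h⟩

/-- The cost of a nontrivial call of `Path` is bounded below by a constant. -/
theorem exists_pos_le_queries_path (hK : 1 ≤ K) (hα : Admissible D K α) (hκ : 0 < κ) :
    ∃ c > 0, ∀ (n : ℕ) (G : Subgraph D n) (s t : Vertex D n), s < t →
      c ≤ (path K α s t).queries κ G := by
  have hμ0 : 0 < min κ 1 := lt_min hκ one_pos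
  -- Beyond weight difference `1 / a` one has `W_1 ≥ 1`, so the precalculation already queries an
  -- edge; below it the recursion depth is bounded independently of `n`.
  obtain ⟨a, ha, haα⟩ := exists_pos_le_of_finset (Finset.Icc 1 D) (α 1)
    (hα.pos 1 (Finset.mem_Icc.2 ⟨le_rfl, hK⟩))
  refine ⟨min κ 1 ^ (2 * ⌈1 / a⌉₊), by positivity, fun n G s t h => ?_⟩
  have hst := weight_strictMono h
  rcases le_total (weight t - weight s) ⌈1 / a⌉₊ with hN | hN
  · exact pow_le_queries_path hK hα hκ G _ s t h hN
  · refine (pow_le_one₀ hμ0.le (min_le_right _ _)).trans ?_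
    have hW1 : 1 ≤ layerWeight K α s t 1 := by
      rw [layerWeight, if_pos hK, Nat.one_le_floor_iff]
      have h1 : (1 : ℝ) / a ≤ (weight t - weight s : ℕ) := Nat.ceil_le.1 hN
      rw [div_le_iff₀ ha, ← sum_mul_coordCount h.le, Nat.cast_sum, Finset.sum_mul] at h1
      refine h1.trans (Finset.sum_le_sum fun d hd => ?_)
      rw [mul_assoc, mul_comm (α 1 d), Nat.cast_mul]
      exact mul_le_mul_of_nonneg_left (haα d hd) (by positivity)
    rcases queries_path_cases hK hα κ G h.le with hq | ⟨hW, dp, dp', hq⟩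
    · refine le_trans ?_ hq
      exact_mod_cast one_le_card_edgesBelow h hst
    · refine le_trans ?_ ((le_add_of_nonneg_right (QAlg.queries_nonneg hκ.le G _)).trans hq)
      exact_mod_cast one_le_card_edgesBelow h (by omega)

/-- The cost of `Path(s, t)` is at least the square root of the size of the middle layer, up to
a constant factor. -/
theorem exists_mul_card_mid_layer_le (hK : 1 ≤ K) (hα : Admissible D K α) (hκ : 0 < κ) :
    ∃ c > 0, ∀ (n : ℕ) (G : Subgraph D n) (s t : Vertex D n), s < t →
      c * (layer s t ((weight t - weight s) / 2)).card ≤ (path K α s t).queries κ G ^ 2 := by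
  obtain ⟨c, hc, hP⟩ := exists_pos_le_queries_path hK hα hκ
  refine ⟨min 1 (κ ^ 2 * (κ * c) ^ 2), lt_min one_pos (by positivity), fun n G s t h => ?_⟩
  rcases queries_path_cases hK hα κ G h.le with hq | ⟨hW, dp, dp', hq⟩
  · have h1 : ((layer s t ((weight t - weight s) / 2)).card : ℝ) ≤
        (path K α s t).queries κ G :=
      le_trans (by exact_mod_cast card_mid_layer_le_card_edgesBelow h) hq
    have h2 : (1 : ℝ) ≤ (layer s t ((weight t - weight s) / 2)).card := by
      exact_mod_cast card_mid_layer_pos h.le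
    calc _ ≤ 1 * ((layer s t ((weight t - weight s) / 2)).card : ℝ) :=
          mul_le_mul_of_nonneg_right (min_le_left _ _) (Nat.cast_nonneg _)
      _ ≤ _ := by nlinarith
  · have h1 := mul_card_mid_layer_le_sq_queries hK hκ G (hW K hK le_rfl) dp dp' hc.le
      fun u v _ huv _ _ => hP n G u v huv
    calc _ ≤ (κ ^ 2 * (κ * c) ^ 2) * ((layer s t ((weight t - weight s) / 2)).card : ℝ) :=
          mul_le_mul_of_nonneg_right (min_le_right _ _) (Nat.cast_nonneg _)
      _ = κ ^ 2 * ((layer s t ((weight t - weight s) / 2)).card * (κ * c) ^ 2) := by ring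
      _ ≤ _ := h1.trans (pow_le_pow_left₀ (QAlg.queries_nonneg hκ.le G _)
          ((le_add_of_nonneg_left (Nat.cast_nonneg _)).trans hq) 2)

/-- The chains of recursive calls from layer `k` up to layer `j` cover all vertices below `v`
half-way between layers `k` and `k + 1`. -/
theorem mul_card_layer_le_sq_queries_layerPath (hκ : 0 < κ) (G : Subgraph D n)
    (P : Vertex D n → Vertex D n → LatticeAlg D n) {W : ℕ → ℕ} {s : Vertex D n}
    (dp : Vertex D n → Bool) (hW : ∀ k, 1 ≤ k → k ≤ K → W k < W (k + 1)) {c : ℝ} (hc : 0 ≤ c)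
    (hP : ∀ u v, u < v →
      c * (layer u v ((weight v - weight u) / 2)).card ≤ (P u v).queries κ G ^ 2)
    {k : ℕ} (hk : 1 ≤ k) {j : ℕ} (hkj : k + 1 ≤ j) : j ≤ K + 1 →
    W (k + 1) ≤ W j ∧ ∀ v, s ≤ v → weight v = weight s + W j →
    (min κ 1 ^ 2) ^ j * (c * (layer s v (W k + (W (k + 1) - W k) / 2)).card) ≤
      (layerPath P W s dp j v).queries κ G ^ 2 := by
  classical
  have hμ0 : 0 < min κ 1 := lt_min hκ one_pos
  have hμ : min κ 1 ^ 2 ≤ κ ^ 2 := pow_le_pow_left₀ hμ0.le (min_le_left _ _) 2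
  have hμ1 : min κ 1 ^ 2 ≤ 1 := pow_le_one₀ hμ0.le (min_le_right _ _)
  induction j, hkj using Nat.le_induction with
  | base =>
    intro hj
    refine ⟨le_rfl, fun v hsv hv => ?_⟩
    have hlt := hW k hk (by omega)
    refine le_trans ?_ (mul_sum_le_sq_queries_layerPath hκ G P W s dp hk v
      (fun u => c * (layer u v ((weight v - weight u) / 2)).card)
      fun u hu => Or.inr (hP u v (mem_layerBelow.1 hu).2.1))
    -- A descending step from `w` to layer `k` finds `u ≤ w`, and `w` then lies in the middle layer
    -- of `[u, v]`.
    have hsub : layer s v (W k + (W (k + 1) - W k) / 2) ⊆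
        (layerBelow s v (W k)).biUnion fun u => layer u v ((weight v - weight u) / 2) := by
      intro w hw
      rw [mem_layer] at hw
      obtain ⟨u, hsu, huw, hu⟩ := exists_weight_eq hw.1 (Nat.le_add_right _ (W k)) (by omega)
      refine Finset.mem_biUnion.2 ⟨u, mem_layerBelow.2 ⟨hsu, lt_of_le_of_ne (huw.trans hw.2.1)
        fun hc => by subst hc; omega, hu⟩, mem_layer.2 ⟨huw, hw.2.1, by omega⟩⟩
    have hcard : ((layer s v (W k + (W (k + 1) - W k) / 2)).card : ℝ) ≤
        ∑ u ∈ layerBelow s v (W k), ((layer u v ((weight v - weight u) / 2)).card : ℝ) := by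
      exact_mod_cast (Finset.card_le_card hsub).trans Finset.card_biUnion_le
    rw [← Finset.mul_sum]
    -- Only one VTS is involved here; the higher power is weaker and keeps the exponent uniform in
    -- the induction.
    have h1 : (min κ 1 ^ 2) ^ (k + 1) ≤ κ ^ 2 :=
      (pow_le_of_le_one (by positivity) hμ1 (Nat.succ_ne_zero k)).trans hμ
    gcongr
  | succ j hj' ih =>
    intro hj
    obtain ⟨hWj, ih⟩ := ih (by omega)
    have hlt := hW j (by omega) (by omega)
    have hltk := hW k hk (by omega)
    refine ⟨hWj.trans hlt.le, fun v hsv hv => ?_⟩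
    refine le_trans ?_ (mul_sum_le_sq_queries_layerPath hκ G P W s dp (by omega) v
      (fun u => (min κ 1 ^ 2) ^ j * (c * (layer s u (W k + (W (k + 1) - W k) / 2)).card))
      fun u hu => Or.inl (ih u (mem_layerBelow.1 hu).1 (mem_layerBelow.1 hu).2.2))
    have hsub : layer s v (W k + (W (k + 1) - W k) / 2) ⊆
        (layerBelow s v (W j)).biUnion fun u => layer s u (W k + (W (k + 1) - W k) / 2) := by
      intro w hw
      rw [mem_layer] at hw
      obtain ⟨u, hwu, huv, hu⟩ := exists_weight_eq hw.2.1 (m := weight s + W j)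
        (by omega) (by omega)
      refine Finset.mem_biUnion.2 ⟨u, mem_layerBelow.2 ⟨hw.1.trans hwu, lt_of_le_of_ne huv
        fun hc => by subst hc; omega, hu⟩, mem_layer.2 ⟨hw.1, hwu, hw.2.2⟩⟩
    have hcard : ((layer s v (W k + (W (k + 1) - W k) / 2)).card : ℝ) ≤
        ∑ u ∈ layerBelow s v (W j),
          ((layer s u (W k + (W (k + 1) - W k) / 2)).card : ℝ) := by
      exact_mod_cast (Finset.card_le_card hsub).trans Finset.card_biUnion_le
    rw [← Finset.mul_sum, ← Finset.mul_sum, pow_succ', mul_assoc]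
    gcongr

end LowerBound


/-! ### The exponential lower bound and its consequences -/

section Asymptotics

variable {D K : ℕ} {α : ℕ → ℕ → ℝ} {κ : ℝ}

theorem exists_threshold {W : ℕ → ℕ} {θ K : ℕ} (h1 : W 1 < θ) (hK : θ ≤ W (K + 1)) :
    ∃ k, 1 ≤ k ∧ k ≤ K ∧ W k < θ ∧ θ ≤ W (k + 1) := by
  induction K with
  | zero => exact absurd h1 (not_lt.2 hK)
  | succ K ih =>
    rcases le_or_gt θ (W (K + 1)) with h | h
    · obtain ⟨k, hk1, hkK, hk⟩ := ih h
      exact ⟨k, hk1, by omega, hk⟩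
    · exact ⟨K + 1, by omega, le_rfl, h, hK⟩

/-- The added `1` accounts for `0^n`, the only vertex without an incoming edge. -/
theorem card_le_card_edgesBelow_add_one {n w : ℕ} (V : Finset (Vertex D n))
    (hV : ∀ x ∈ V, weight x ≤ w) :
    V.card ≤ (edgesBelow (bot D n) (top D n) w).card + 1 := by
  classical
  have h := Finset.pred_card_le_card_erase (s := V) (a := bot D n)
  suffices (V.erase (bot D n)).card ≤ (edgesBelow (bot D n) (top D n) w).card by omega
  refine card_le_card_edgesBelow _ fun x hx => ?_
  rw [Finset.mem_erase] at hx
  exact ⟨lt_of_le_of_ne (bot_le x) hx.1.symm, le_top x, hV x hx.2⟩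

theorem pow_div_exp_le_pow_half (D n : ℕ) :
    (((D : ℝ) + 1) / Real.exp 1) ^ n ≤ (((D / 2 + 1) ^ n : ℕ) : ℝ) := by
  rw [Nat.cast_pow]
  refine pow_le_pow_left₀ (by positivity) ?_ n
  have h : ((D : ℝ) + 1) / 2 ≤ ((D / 2 + 1 : ℕ) : ℝ) := by
    rw [div_le_iff₀ (by norm_num)]
    exact_mod_cast (by omega : D + 1 ≤ (D / 2 + 1) * 2)
  refine le_trans ?_ h
  have := Real.exp_one_gt_d9
  gcongr
  linarith

/-- The lower bound on the number of queries of `Path(0^n, D^n)`. -/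
theorem exists_pow_le_mul_queries (hD : 1 ≤ D) (hK : 1 ≤ K) (hα : Admissible D K α)
    (hκ : 0 < κ) : ∃ C > 0, ∀ n ≥ 8, ∀ G : Subgraph D n,
      (((D : ℝ) + 1) / Real.exp 1) ^ n ≤
        C * ((n * D + 1 : ℕ) : ℝ) * (latticePath D n K α).queries κ G := by
  obtain ⟨c, hc, hlow⟩ := exists_pos_le_queries_path hK hα hκ
  obtain ⟨c', hc', hmid⟩ := exists_mul_card_mid_layer_le hK hα hκ
  have hμ0 : 0 < min κ 1 := lt_min hκ one_pos
  set b : ℝ := κ ^ 2 * ((min κ 1 ^ 2) ^ (K + 1) * c') with hb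
  have hb0 : 0 < b := by positivity
  refine ⟨max (2 * (1 + 1 / c)) (√(2 / b)), lt_max_of_lt_left (by positivity),
    fun n hn G => ?_⟩
  have hnD : 8 ≤ n * D := by nlinarith
  have hlt : bot D n < top D n := lt_of_le_of_ne (bot_le _) fun h => by
    have := congrArg weight h
    rw [weight_bot, weight_top] at this
    omega
  have hN : (1 : ℝ) ≤ ((n * D + 1 : ℕ) : ℝ) := by exact_mod_cast Nat.le_add_left 1 _
  have hT : latticePath D n K α = path K α (bot D n) (top D n) := rfl
  rw [hT]
  have hlow' := hlow n G _ _ hlt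
  set T := (path K α (bot D n) (top D n)).queries κ G with hTdef
  have hT0 : 0 < T := hc.trans_le hlow'
  -- It suffices to compare the cost with the number of vertices whose edges are queried.
  have suff : ∀ E : ℕ, (E : ℝ) ≤ T → (D / 2 + 1) ^ n ≤ 2 * (E + 1) →
      (((D : ℝ) + 1) / Real.exp 1) ^ n ≤
        max (2 * (1 + 1 / c)) (√(2 / b)) * ((n * D + 1 : ℕ) : ℝ) * T := by
    intro E hE hle
    have h1 : (((D : ℝ) + 1) / Real.exp 1) ^ n ≤ 2 * (E + 1) :=
      (pow_div_exp_le_pow_half D n).trans (by exact_mod_cast hle)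
    have h2 : 1 ≤ 1 / c * T := by rw [one_div, ← div_eq_inv_mul, one_le_div hc]; exact hlow'
    calc _ ≤ 2 * ((E : ℝ) + 1) := h1
      _ ≤ 2 * (1 + 1 / c) * 1 * T := by linarith
      _ ≤ _ := by
        gcongr
        exact le_max_left _ _
  rcases queries_path_cases hK hα κ G (bot_le (top D n)) with hq | ⟨hW, dp, dp', hq⟩
  · refine suff _ hq ?_
    have h := card_le_card_edgesBelow_add_one (Finset.univ : Finset (Vertex D n))
      (w := weight (top D n)) fun x _ => weight_mono (le_top x)
    rw [Finset.card_univ, Fintype.card_fun, Fintype.card_fin, Fintype.card_fin] at h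
    have h' : (D / 2 + 1) ^ n ≤ (D + 1) ^ n := Nat.pow_le_pow_left (by omega) n
    omega
  · rw [weight_bot, zero_add, weight_top, Nat.sub_zero] at hq
    set W := layerWeight K α (bot D n) (top D n) with hWdef
    have hWK : W (K + 1) = n * D / 2 := by
      rw [hWdef, layerWeight_succ_self, weight_bot, weight_top, Nat.sub_zero]
    -- The threshold is about `nD/4`. In the first case the box `[0, ⌊D/2⌋]^n` has half its points
    -- at weight at most `W 1`, all reached by precalculation edges except possibly `0^n`.
    rcases le_or_gt (n * D / 2 + 1 - 2 * (n * D / 8)) (W 1) with h1 | h1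
    · refine suff _ ((le_add_of_nonneg_right (QAlg.queries_nonneg hκ.le G _)).trans hq) ?_
      have hbw : weight (fun _ => ⟨D / 2, by omega⟩ : Vertex D n) ≤ 2 * W 1 + 1 := by
        have : weight (fun _ => ⟨D / 2, by omega⟩ : Vertex D n) = n * (D / 2) := by
          simp [weight]
        have h2 : n * (D / 2) ≤ n * D / 2 := Nat.mul_div_le_mul_div_assoc n D 2
        omega
      have h2 := prod_le_two_mul_card (fun _ => ⟨D / 2, by omega⟩ : Vertex D n) hbw
      rw [Finset.prod_const, Finset.card_univ, Fintype.card_fin] at h2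
      refine h2.trans (Nat.mul_le_mul_left 2 ?_)
      exact card_le_card_edgesBelow_add_one _ fun x hx => (Finset.mem_filter.1 hx).2
    · obtain ⟨k, hk1, hkK, hk, hk'⟩ := exists_threshold (K := K) h1 (by omega)
      have hmono : W (k + 1) ≤ n * D / 2 ∧ ∀ v, bot D n ≤ v →
          weight v = weight (bot D n) + n * D / 2 → _ :=
        hWK ▸ mul_card_layer_le_sq_queries_layerPath hκ G (path K α) dp hW hc'.le
          (fun u v huv => hmid n G u v huv) hk1 (j := K + 1) (by omega) le_rfl
      obtain ⟨hle, hL⟩ := hmono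
      have hkk := hW k hk1 hkK
      -- With `W k ≤ nD/2 - 2⌊nD/8⌋` and `W (k + 1) ≤ nD/2` the average stays at most `nD/2 -
      -- ⌊nD/8⌋`; the lower bound on `W (k + 1)` makes it at least `⌊nD/8⌋`.
      have hcount := pow_sum_le_mul_sum_card_layer D n (M := W k + (W (k + 1) - W k) / 2)
        (by omega) (by omega)
      have hvts := mul_sum_le_sq_queries_mid hκ G (layer (bot D n) (top D n) (n * D / 2))
        (fun v => layerPath (path K α) W (bot D n) dp (K + 1) v.1)
        (fun v => layerPath' (path K α) W (top D n) dp' (K + 1) v.1)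
        (fun v => (min κ 1 ^ 2) ^ (K + 1) *
          (c' * (layer (bot D n) v (W k + (W (k + 1) - W k) / 2)).card))
        fun v => hL v.1 (bot_le _) (mem_layer.1 v.2).2.2
      rw [← Finset.mul_sum, ← Finset.mul_sum] at hvts
      have hTsq := hvts.trans (pow_le_pow_left₀ (QAlg.queries_nonneg hκ.le G _)
        ((le_add_of_nonneg_left (Nat.cast_nonneg _)).trans hq) 2)
      set S : ℝ := ∑ v ∈ layer (bot D n) (top D n) (n * D / 2),
        ((layer (bot D n) v (W k + (W (k + 1) - W k) / 2)).card : ℝ) with hS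
      have hbS : b * S ≤ T ^ 2 := by
        refine le_trans (le_of_eq ?_) hTsq
        rw [hb]; ring
      have hS0 : 0 ≤ S := Finset.sum_nonneg fun _ _ => Nat.cast_nonneg _
      have hcount' : ((((D : ℝ) + 1) / Real.exp 1) ^ n) ^ 2 ≤
          2 * ((n * D + 1 : ℕ) : ℝ) ^ 2 * S := by
        calc ((((D : ℝ) + 1) / Real.exp 1) ^ n) ^ 2
            = ((((D : ℝ) + 1) / Real.exp 1) ^ 2) ^ n := by rw [← pow_mul, ← pow_mul, mul_comm]
          _ ≤ ((∑ j : Fin (D + 1), ((j : ℕ) * (D - j) / D + 1) : ℕ) : ℝ) ^ n :=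
              pow_le_pow_left₀ (by positivity) (sq_div_exp_le_sum hD) n
          _ ≤ (((n * D + 1) * (2 * (n * D / 8 + 1)) : ℕ) : ℝ) * S := by
              rw [hS]; exact_mod_cast hcount
          _ ≤ ((2 * (n * D + 1) ^ 2 : ℕ) : ℝ) * S := by
              refine mul_le_mul_of_nonneg_right (Nat.cast_le.2 ?_) hS0
              have : n * D / 8 ≤ n * D := Nat.div_le_self _ _
              nlinarith
          _ = _ := by push_cast; ring
      have hfin : ((((D : ℝ) + 1) / Real.exp 1) ^ n) ^ 2 ≤
          (√(2 / b) * ((n * D + 1 : ℕ) : ℝ) * T) ^ 2 := by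
        rw [mul_pow, mul_pow, Real.sq_sqrt (by positivity)]
        calc _ ≤ _ := hcount'
          _ = 2 / b * ((n * D + 1 : ℕ) : ℝ) ^ 2 * (b * S) := by field_simp
          _ ≤ _ := by gcongr
      refine ((pow_le_pow_iff_left₀ (by positivity) (by positivity) two_ne_zero).1 hfin).trans ?_
      gcongr
      exact le_max_right _ _

/-- No integer equals `e`. Hence `log (r ^ n) = n * log r` really grows linearly for `r = (D + 1) /
e` and absorbs the factor `n * D + 1`; for `D = 1` it is negative, so its absolute value is what
counts. -/
theorem log_div_exp_ne_zero (D : ℕ) : Real.log (((D : ℝ) + 1) / Real.exp 1) ≠ 0 := by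
  refine Real.log_ne_zero_of_pos_of_ne_one (by positivity) fun h => ?_
  rw [div_eq_one_iff_eq (Real.exp_pos 1).ne'] at h
  have h1 := Real.exp_one_gt_d9
  have h2 := Real.exp_one_lt_d9
  rw [← h] at h1 h2
  have h3 : 2 < D + 1 := by exact_mod_cast (by linarith : (2 : ℝ) < D + 1)
  have h4 : D + 1 < 3 := by exact_mod_cast (by linarith : (D : ℝ) + 1 < 3)
  omega

theorem isOmegaTilde_queries (hD : 1 ≤ D) (hK : 1 ≤ K) (hα : Admissible D K α) (hκ : 0 < κ)
    (G : ∀ n : ℕ, Subgraph D n) :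
    IsOmegaTilde (fun n => (latticePath D n K α).queries κ (G n))
      (fun n => (((D : ℝ) + 1) / Real.exp 1) ^ n) := by
  obtain ⟨C, hC, h⟩ := exists_pow_le_mul_queries hD hK hα hκ
  refine ⟨1, Asymptotics.IsBigO.of_bound
    (C * (2 * D) / |Real.log (((D : ℝ) + 1) / Real.exp 1)|) ?_⟩
  filter_upwards [Filter.eventually_ge_atTop 8] with n hn
  have hlog : 0 < |Real.log (((D : ℝ) + 1) / Real.exp 1)| := abs_pos.2 (log_div_exp_ne_zero D)
  have hn0 : (0 : ℝ) < n := by exact_mod_cast (by omega : 0 < n)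
  have hq := QAlg.queries_nonneg hκ.le (G n) (latticePath D n K α)
  have hN : ((n * D + 1 : ℕ) : ℝ) ≤ n * (2 * D) := by
    exact_mod_cast (by nlinarith : n * D + 1 ≤ n * (2 * D))
  rw [pow_one, Real.log_pow, abs_mul, Nat.abs_cast, Real.norm_of_nonneg (by positivity),
    Real.norm_of_nonneg hq, div_le_iff₀ (by positivity)]
  calc _ ≤ _ := h n hn (G n)
    _ ≤ C * (n * (2 * D)) * (latticePath D n K α).queries κ (G n) := by gcongr
    _ = _ := by field_simp

theorem not_isOTilde_queries (hD : 1 ≤ D) (hK : 1 ≤ K) (hα : Admissible D K α) (hκ : 0 < κ)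
    (G : ∀ n : ℕ, Subgraph D n) {c : ℝ}
    (hc : ((D : ℝ) + 1) ^ c < ((D : ℝ) + 1) / Real.exp 1) :
    ¬ IsOTilde (fun n => (latticePath D n K α).queries κ (G n))
      (fun n => ((D : ℝ) + 1) ^ (c * n)) := by
  rintro ⟨m, hm⟩
  obtain ⟨C, hC, h⟩ := exists_pow_le_mul_queries hD hK hα hκ
  obtain ⟨B, hB, hm⟩ := hm.exists_pos
  rw [Asymptotics.isBigOWith_iff] at hm
  set b : ℝ := ((D : ℝ) + 1) ^ c with hb
  set r : ℝ := ((D : ℝ) + 1) / Real.exp 1 with hr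
  have hb0 : 0 < b := by positivity
  have hr0 : 0 < r := by positivity
  set A : ℝ := C * (2 * D) * (B * |Real.log b| ^ m) with hA
  -- The exponent `m + 1` collects `m` logarithms and the factor `n * D + 1`; since `b < r`, the
  -- ratio `(r / b) ^ n` outgrows it.
  have hlim := (tendsto_pow_const_div_const_pow_of_one_lt (m + 1)
    ((one_lt_div hb0).2 hc)).const_mul A
  rw [mul_zero] at hlim
  obtain ⟨n, hlt, hmn, hn⟩ := ((hlim.eventually (gt_mem_nhds one_pos)).and
    (hm.and (Filter.eventually_ge_atTop 8))).exists
  have hn0 : (0 : ℝ) < n := by exact_mod_cast (by omega : 0 < n)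
  have hN : ((n * D + 1 : ℕ) : ℝ) ≤ n * (2 * D) := by
    exact_mod_cast (by nlinarith : n * D + 1 ≤ n * (2 * D))
  have hq := QAlg.queries_nonneg hκ.le (G n) (latticePath D n K α)
  have hpow : ((D : ℝ) + 1) ^ (c * n) = b ^ n := by
    rw [hb, Real.rpow_mul (by positivity), Real.rpow_natCast]
  dsimp only at hmn
  rw [hpow, Real.log_pow, abs_mul, Nat.abs_cast, Real.norm_of_nonneg hq,
    Real.norm_of_nonneg (by positivity)] at hmn
  have hle : r ^ n ≤ A * n ^ (m + 1) * b ^ n := by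
    calc r ^ n ≤ _ := h n hn (G n)
      _ ≤ C * (n * (2 * D)) * (B * (b ^ n * (n * |Real.log b|) ^ m)) := by gcongr
      _ = _ := by rw [hA, mul_pow]; ring
  rw [div_pow, ← mul_div_assoc, div_lt_one (by positivity), lt_div_iff₀ (by positivity)] at hlt
  exact absurd hle (not_le.2 hlt)

/-- Equivalent to `(D + 1) ^ (1 - c) > e`, where the left side tends to infinity. -/
theorem exists_rpow_lt_div_exp {c : ℝ} (hc : c < 1) :
    ∃ D₀ : ℕ, 1 ≤ D₀ ∧ ∀ D : ℕ, D₀ ≤ D →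
      ((D : ℝ) + 1) ^ c < ((D : ℝ) + 1) / Real.exp 1 := by
  have h := (tendsto_rpow_atTop (sub_pos.2 hc)).comp
    (Filter.tendsto_atTop_add_const_right _ (1 : ℝ) tendsto_natCast_atTop_atTop)
  obtain ⟨D₀, hD₀⟩ := Filter.eventually_atTop.1 (h.eventually_gt_atTop (Real.exp 1))
  refine ⟨D₀ + 1, by omega, fun D hD => ?_⟩
  have hpos : (0 : ℝ) < (D : ℝ) + 1 := by positivity
  have h1 := hD₀ D (by omega)
  simp only [Function.comp] at h1
  rw [lt_div_iff₀ (Real.exp_pos 1)]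
  calc ((D : ℝ) + 1) ^ c * Real.exp 1 < ((D : ℝ) + 1) ^ c * ((D : ℝ) + 1) ^ (1 - c) := by gcongr
    _ = (D : ℝ) + 1 := by rw [← Real.rpow_add hpos, add_sub_cancel, Real.rpow_one]

end Asymptotics

end Hyperlattice

theorem theorem6 :
    (∀ D K : ℕ, 1 ≤ D → 1 ≤ K →
      ∀ α : ℕ → ℕ → ℝ, Hyperlattice.Admissible D K α →
      ∀ κ : ℝ, 0 < κ → ∀ G : ∀ n : ℕ, Hyperlattice.Subgraph D n,
        Hyperlattice.IsOmegaTilde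
          (fun n => (Hyperlattice.latticePath D n K α).queries κ (G n))
          (fun n => (((D : ℝ) + 1) / Real.exp 1) ^ n)) ∧
    (∀ c : ℝ, c < 1 → ∃ D₀ : ℕ, ∀ D K : ℕ, D₀ ≤ D → 1 ≤ K →
      ∀ α : ℕ → ℕ → ℝ, Hyperlattice.Admissible D K α →
      ∀ κ : ℝ, 0 < κ → ∀ G : ∀ n : ℕ, Hyperlattice.Subgraph D n,
        ¬ Hyperlattice.IsOTilde
          (fun n => (Hyperlattice.latticePath D n K α).queries κ (G n))
          (fun n => ((D : ℝ) + 1) ^ (c * n))) := by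
  refine ⟨fun D K hD hK α hα κ hκ G => Hyperlattice.isOmegaTilde_queries hD hK hα hκ G,
    fun c hc => ?_⟩
  obtain ⟨D₀, h1, h⟩ := Hyperlattice.exists_rpow_lt_div_exp hc
  exact ⟨D₀, fun D K hD hK α hα κ hκ G =>
    Hyperlattice.not_isOTilde_queries (h1.trans hD) hK hα hκ G (h D hD)⟩
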